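/- **Theorem (Existence of fast solutions).** Let $H$ be a real Hilbert space and let $A$ be a self-adjoint nonnegative linear operator on $H$ with dense domain $D(A)$, whose spectrum is a finite set or an increasing sequence of eigenvalues. For $u\in D(A^{1/2})$ put $|u|_{D(A^{1/2})}=(|u|^2+|A^{1/2}u|^2)^{1/2}$, let $R>0$, $B_R=\{u\in D(A^{1/2}):|u|_{D(A^{1/2})}<R\}$, and let $f:B_R\to H$ be a function with $f(0)=0$ such that, for some $p>0$ and $L\ge 0$, $$|f(u)-f(v)|\le L\bigl(|u|_{D(A^{1/2})}^p+|v|_{D(A^{1/2})}^p\bigr)\,|u-v|_{D(A^{1/2})}\qquad\text{for all }u,v\in B_R .$$ For $u_0\in B_R$ and $T>0$, a *solution on $[0,T]$* of $$u'(t)+Au(t)=f(u(t)),\qquad u(0)=u_0, \tag{1}$$ is a function $u:[0,T]\to B_R$ with $u(0)=u_0$, $u\in C^0([0,T],D(A^{1/2}))\cap W^{1,2}((0,T),H)\cap L^2((0,T),D(A))$, with $t\mapsto|A^{1/2}u(t)|^2$ absolutely continuous on $[0,T]$, and such that for almost every $t\in(0,T)$ the derivative $u'(t)$ exists, $u(t)\in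 D(A)$ and the equation in (1) holds. Let $\lambda>0$ be an eigenvalue of $A$. Let $H_-$ (respectively $H_+$) be the closure of the subspace generated by all eigenvectors of $A$ relative to eigenvalues less than or equal to $\lambda$ (respectively greater than $\lambda$). Then $H_+$ is the orthogonal complement of $H_-$, so that $H=H_-\oplus H_+$, and there exists $r_0>0$ with the following property. For every $v_0\in\ker(A-\lambda I)$ and every $w_0\in H_+\cap D(A^{1/2})$ with $$|v_0|_{D(A^{1/2})}+|w_0|_{D(A^{1/2})}\le r_0,$$ there exists $w_1\in H_-$ such that $u_0:=w_0+w_1\in B_R$ and problem (1) with this $u_0$ has a global solution $u:[0,+\infty)\to B_R$ (a solution on $[0,T]$ for every $T>0$), which is unique (for every $T>0$, every solution of (1) on $[0,T]$ coincides with $u$ on $[0,T]$) and satisfies $$\lim_{t\to+\infty}\bigl|e^{\lambda t}u(t)-v_0\bigr|_{D(A^{1/2})}=0 .$$ -/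

import Mathlib

open MeasureTheory Set Filter Topology

noncomputable section

namespace FastSolutions

variable {H : Type*} [NormedAddCommGroup H] [InnerProductSpace ℝ H]

/-- The operator `A` is nonnegative: `⟨A u, u⟩ ≥ 0` for every `u ∈ D(A)`. -/
def IsNonneg (A : H →ₗ.[ℝ] H) : Prop :=
  ∀ u : A.domain, 0 ≤ inner ℝ (A u) (u : H)

/-- `ker (A - μ)`: the vectors `x ∈ D(A)` with `A x = μ x`. -/
def eigenspace (A : H →ₗ.[ℝ] H) (μ : ℝ) : Submodule ℝ H :=
  A.graph.comap (LinearMap.prod LinearMap.id (μ • LinearMap.id))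

/-- `μ` is an eigenvalue of `A`. -/
def IsEigenvalue (A : H →ₗ.[ℝ] H) (μ : ℝ) : Prop :=
  ∃ x ∈ eigenspace A μ, x ≠ 0

/-- The (real) spectrum of an unbounded operator: the `μ` for which `A - μ : D(A) → H` has no
bounded two-sided inverse `R`. The spectrum of a self-adjoint operator is real. -/
def spectrum (A : H →ₗ.[ℝ] H) : Set ℝ :=
  {μ | ¬ ∃ R : H →L[ℝ] H,
      (∀ y : H, ∃ h : R y ∈ A.domain, A ⟨R y, h⟩ - μ • R y = y) ∧
      (∀ x : A.domain, R (A x - μ • (x : H)) = x)}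

/-- The spectrum of `A` is a finite set or an increasing sequence of eigenvalues. -/
def HasDiscreteSpectrum (A : H →ₗ.[ℝ] H) : Prop :=
  (∀ μ ∈ spectrum A, IsEigenvalue A μ) ∧
    ((spectrum A).Finite ∨ ∃ l : ℕ → ℝ, StrictMono l ∧ spectrum A = range l)

/-- `H₋`: the closure of the span of the eigenvectors with eigenvalue at most `lam`. -/
def lowerSpace (A : H →ₗ.[ℝ] H) (lam : ℝ) : Submodule ℝ H :=
  (⨆ μ ∈ Iic lam, eigenspace A μ).topologicalClosure

/-- `H₊`: the closure of the span of the eigenvectors with eigenvalue greater than `lam`. -/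
def upperSpace (A : H →ₗ.[ℝ] H) (lam : ℝ) : Submodule ℝ H :=
  (⨆ μ ∈ Ioi lam, eigenspace A μ).topologicalClosure

variable [CompleteSpace H]

/-- The spectral projection of `A` at the point `μ`: the orthogonal projection onto `ker (A - μ)`.
(The kernel is already closed when `A` is a closed operator, in particular if `A` is
self-adjoint.) -/
def eigenproj (A : H →ₗ.[ℝ] H) (μ : ℝ) : H →L[ℝ] H :=
  (eigenspace A μ).topologicalClosure.starProjection

/-- The square root `A^{1/2}` of a nonnegative self-adjoint operator with discrete spectrum,
given by the functional calculus: `A^{1/2} u = ∑ √μ P_μ u`, the sum being over the eigenvalues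
(`P_μ = 0` at all other `μ`), with domain the set of all `u` for which this orthogonal series
converges in `H`, that is, for which `∑ μ ‖P_μ u‖² < ∞`. -/
def sqrtOp (A : H →ₗ.[ℝ] H) : H →ₗ.[ℝ] H where
  domain :=
    { carrier := {u | Summable fun μ : ℝ => √μ • eigenproj A μ u}
      add_mem' := fun {a b} ha hb => by
        have := Summable.add ha hb
        simpa only [mem_ofPred_eq, map_add, smul_add] using this
      zero_mem' := by simp
      smul_mem' := fun c a ha => by
        have := Summable.const_smul c ha
        simpa only [mem_ofPred_eq, map_smul, smul_comm c] using this }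
  toFun :=
    { toFun := fun u => ∑' μ : ℝ, √μ • eigenproj A μ (u : H)
      map_add' := fun a b => by
        rw [← Summable.tsum_add a.2 b.2]
        simp only [Submodule.coe_add, map_add, smul_add]
      map_smul' := fun c a => by
        rw [RingHom.id_apply, ← Summable.tsum_const_smul c a.2]
        simp only [Submodule.coe_smul, map_smul, smul_comm c] }

open Classical in
/-- `‖A^{1/2} u‖` for `u ∈ D(A^{1/2})` (with the value `0` elsewhere, which is never used). -/
def sqrtNorm (A : H →ₗ.[ℝ] H) (u : H) : ℝ :=
  if h : u ∈ (sqrtOp A).domain then ‖sqrtOp A ⟨u, h⟩‖ else 0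

/-- The norm `(|u|² + |A^{1/2} u|²)^{1/2}` of `D(A^{1/2})`, for `u ∈ D(A^{1/2})`. -/
def halfNorm (A : H →ₗ.[ℝ] H) (u : H) : ℝ :=
  √(‖u‖ ^ 2 + sqrtNorm A u ^ 2)

/-- The open ball `B_R` of `D(A^{1/2})`. -/
def halfBall (A : H →ₗ.[ℝ] H) (R : ℝ) : Set H :=
  {u | u ∈ (sqrtOp A).domain ∧ halfNorm A u < R}

/-- `u` is a (strong) solution on `[0, T]` of `u' + A u = f(u)`, `u(0) = u₀`, where `f` is regarded
as a function on `B_R` only: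
* `u` takes values in `B_R` and is continuous on `[0, T]` with respect to the norm of `D(A^{1/2})`;
* `u ∈ W^{1,2}((0,T), H) ∩ L²((0,T), D(A))`: here `du` is the derivative of `u` and `Au` is `A u`;
* the function `t ↦ |A^{1/2} u(t)|²` is absolutely continuous on `[0, T]`;
* the equation holds for almost every `t ∈ (0, T)`. -/
structure IsSolutionOn (A : H →ₗ.[ℝ] H) (R : ℝ) (f : H → H) (u₀ : H) (T : ℝ) (u : ℝ → H) :
    Prop where
  init : u 0 = u₀
  mem_ball : ∀ t ∈ Icc 0 T, u t ∈ halfBall A R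
  cont : ∀ t ∈ Icc 0 T, Tendsto (fun s => halfNorm A (u s - u t)) (𝓝[Icc 0 T] t) (𝓝 0)
  strong : ∃ du Au : ℝ → H,
    MemLp u 2 (volume.restrict (Ioo 0 T)) ∧
    MemLp du 2 (volume.restrict (Ioo 0 T)) ∧
    MemLp Au 2 (volume.restrict (Ioo 0 T)) ∧
    (∀ t ∈ Icc 0 T, u t = u 0 + ∫ s in (0 : ℝ)..t, du s) ∧
    ∀ᵐ t ∂(volume.restrict (Ioo 0 T)),
      HasDerivAt u (du t) t ∧
      (∃ h : u t ∈ A.domain, A ⟨u t, h⟩ = Au t) ∧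
      du t + Au t = f (u t)
  energy_ac : AbsolutelyContinuousOnInterval (fun t => sqrtNorm A (u t) ^ 2) 0 T

/-- `u` is a global solution, and it is the unique one: every solution with the same initial datum
on any interval `[0, T]` coincides with `u` there. So `u` is the maximal continuation of the unique
local solution, and its maximal existence time is `+∞`. -/
def IsUniqueGlobalSolution (A : H →ₗ.[ℝ] H) (R : ℝ) (f : H → H) (u₀ : H) (u : ℝ → H) : Prop :=
  (∀ T > 0, IsSolutionOn A R f u₀ T u) ∧
    ∀ T > 0, ∀ v : ℝ → H, IsSolutionOn A R f u₀ T v → ∀ t ∈ Icc 0 T, v t = u t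

end FastSolutions

end

namespace FastSolutions

variable {H : Type*} [NormedAddCommGroup H] [InnerProductSpace ℝ H] {ι : Type*}

/-- A family of mutually orthogonal projections summing to the identity. -/
structure IsResolution (P : ι → H →L[ℝ] H) : Prop where
  sym : ∀ i x y, inner ℝ (P i x) y = inner ℝ x (P i y)
  idem : ∀ i x, P i (P i x) = P i x
  orth : ∀ i j, i ≠ j → ∀ x, P i (P j x) = 0
  hasSum : ∀ x, HasSum (fun i => P i x) x

namespace IsResolution

variable {P : ι → H →L[ℝ] H}

theorem inner_proj (hP : IsResolution P) (i : ι) (x y : H) :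
    inner ℝ (P i x) (P i y) = inner ℝ x (P i y) := by
  rw [hP.sym, hP.idem]

theorem hasSum_inner (hP : IsResolution P) (x y : H) :
    HasSum (fun i => inner ℝ (P i x) (P i y)) (inner ℝ x y) := by
  simp_rw [hP.inner_proj]
  exact (hP.hasSum y).mapL (innerSL ℝ x)

theorem hasSum_norm_sq (hP : IsResolution P) (x : H) :
    HasSum (fun i => ‖P i x‖ ^ 2) (‖x‖ ^ 2) := by
  simpa only [real_inner_self_eq_norm_sq] using hP.hasSum_inner x x

theorem ext (hP : IsResolution P) {x y : H} (h : ∀ i, P i x = P i y) : x = y :=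
  (hP.hasSum x).unique (by simpa only [h] using hP.hasSum y)

theorem orthogonalFamily (hP : IsResolution P) :
    OrthogonalFamily ℝ (fun i => (LinearMap.range (P i : H →ₗ[ℝ] H)))
      fun i => (LinearMap.range (P i : H →ₗ[ℝ] H)).subtypeₗᵢ := by
  rintro i j hij ⟨_, x, rfl⟩ ⟨_, y, rfl⟩
  change inner ℝ (P i x) (P j y) = 0
  rw [hP.sym, hP.orth i j hij, inner_zero_right]

theorem exists_of_summable [CompleteSpace H] (hP : IsResolution P) {c : ι → H}
    (hc : ∀ i, P i (c i) = c i) (hs : Summable fun i => ‖c i‖ ^ 2) :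
    ∃ y, HasSum c y ∧ ∀ i, P i y = c i := by
  have h := (hP.orthogonalFamily.summable_iff_norm_sq_summable
    (fun i => ⟨c i, c i, hc i⟩)).2 hs
  have h' : Summable c := h
  refine ⟨_, h'.hasSum, fun j => ?_⟩
  refine (h'.hasSum.mapL (P j)).unique ?_
  have : ∀ i, i ≠ j → P j (c i) = 0 := fun i hi => by
    rw [← hc i, hP.orth j i hi.symm]
  simpa [hc] using hasSum_single j this

theorem summable_iff [CompleteSpace H] (hP : IsResolution P) {c : ι → H}
    (hc : ∀ i, P i (c i) = c i) : Summable c ↔ Summable fun i => ‖c i‖ ^ 2 :=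
  hP.orthogonalFamily.summable_iff_norm_sq_summable (fun i => ⟨c i, c i, hc i⟩)

theorem norm_proj_le (hP : IsResolution P) (i : ι) (x : H) : ‖P i x‖ ≤ ‖x‖ := by
  have := le_hasSum (hP.hasSum_norm_sq x) i fun _ _ => sq_nonneg _
  exact abs_le_of_sq_le_sq' this (norm_nonneg _) |>.2

theorem sum_norm_sq_le (hP : IsResolution P) (F : Finset ι) (x : H) :
    ∑ i ∈ F, ‖P i x‖ ^ 2 ≤ ‖x‖ ^ 2 :=
  sum_le_hasSum F (fun _ _ => sq_nonneg _) (hP.hasSum_norm_sq x)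

/-- Componentwise convergence together with convergence of the norms gives strong convergence. -/
theorem tendsto_of_proj (hP : IsResolution P) {α : Type*} {l : Filter α} {y : α → H} {z : H}
    (hc : ∀ i, Tendsto (fun a => P i (y a)) l (𝓝 (P i z)))
    (hn : Tendsto (fun a => ‖y a‖ ^ 2) l (𝓝 (‖z‖ ^ 2))) : Tendsto y l (𝓝 z) := by
  have hw : Tendsto (fun a => inner ℝ (y a - z) z) l (𝓝 0) := by
    rw [Metric.tendsto_nhds]
    intro ε hε
    have hK : 0 < 2 * ‖z‖ + 1 := by positivity
    obtain ⟨F, hF⟩ := ((Metric.tendsto_nhds.1 (hP.hasSum z)) (ε / 2 / (2 * ‖z‖ + 1))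
      (by positivity)).exists
    have h1 : Tendsto (fun a => inner ℝ (y a - z) (∑ i ∈ F, P i z)) l (𝓝 0) := by
      have : Tendsto (fun a => ∑ i ∈ F, inner ℝ (P i (y a) - P i z) z) l
          (𝓝 (∑ i ∈ F, inner ℝ (P i z - P i z) z)) :=
        tendsto_finsetSum _ fun i _ => ((hc i).sub_const _).inner tendsto_const_nhds
      simpa [inner_sum, ← hP.sym, map_sub] using this
    have h2 : ∀ᶠ a in l, ‖y a‖ ^ 2 < (‖z‖ + 1) ^ 2 :=
      hn.eventually_lt_const (by nlinarith [norm_nonneg z])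
    filter_upwards [(Metric.tendsto_nhds.1 h1) (ε / 2) (by positivity), h2] with a ha hb
    have hb' : ‖y a‖ ≤ ‖z‖ + 1 := (lt_of_pow_lt_pow_left₀ 2 (by positivity) hb).le
    rw [dist_zero_right] at ha ⊢
    rw [dist_comm, dist_eq_norm] at hF
    have h3 : inner ℝ (y a - z) z = inner ℝ (y a - z) (∑ i ∈ F, P i z)
        + inner ℝ (y a - z) (z - ∑ i ∈ F, P i z) := by rw [← inner_add_right]; simp
    have h4 : ‖inner ℝ (y a - z) (z - ∑ i ∈ F, P i z)‖ ≤ ε / 2 := by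
      calc _ ≤ ‖y a - z‖ * ‖z - ∑ i ∈ F, P i z‖ := norm_inner_le_norm _ _
        _ ≤ (2 * ‖z‖ + 1) * (ε / 2 / (2 * ‖z‖ + 1)) := by
          gcongr
          linarith [norm_sub_le (y a) z]
        _ = ε / 2 := by field_simp
    rw [h3]
    linarith [norm_add_le (inner ℝ (y a - z) (∑ i ∈ F, P i z))
      (inner ℝ (y a - z) (z - ∑ i ∈ F, P i z))]
  have h5 : Tendsto (fun a => ‖y a - z‖ ^ 2) l (𝓝 0) := by
    have h6 : ∀ a, ‖y a - z‖ ^ 2 = ‖y a‖ ^ 2 - ‖z‖ ^ 2 - 2 * inner ℝ (y a - z) z := fun a => by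
      rw [@norm_sub_sq_real, inner_sub_left, real_inner_self_eq_norm_sq]; ring
    simp_rw [h6]
    have := (hn.sub_const (‖z‖ ^ 2)).sub (hw.const_mul 2)
    rwa [sub_self, mul_zero, sub_zero] at this
  rw [tendsto_iff_norm_sub_tendsto_zero]
  have := h5.sqrt
  simpa [Real.sqrt_sq (norm_nonneg _)] using this

end IsResolution

end FastSolutions

namespace FastSolutions

variable {H : Type*} [NormedAddCommGroup H] [InnerProductSpace ℝ H] {ι : Type*}

/-- The energy estimate for the scalar equation `c' = h - m c`. -/
theorem integral_sq_le_of_hasDerivAt {m : ℝ} (hm : 0 ≤ m) {c h : ℝ → H} (hh : Continuous h)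
    (hc : ∀ t, HasDerivAt c (h t - m • c t) t) {T : ℝ} (hT : 0 ≤ T) :
    ∫ t in (0 : ℝ)..T, m ^ 2 * ‖c t‖ ^ 2 ≤ m * ‖c 0‖ ^ 2 + ∫ t in (0 : ℝ)..T, ‖h t‖ ^ 2 := by
  have hcc : Continuous c := continuous_iff_continuousAt.2 fun t => (hc t).continuousAt
  have hd : ∀ t, HasDerivAt (fun t => m * ‖c t‖ ^ 2) (m * (2 * inner ℝ (c t) (h t - m • c t))) t :=
    fun t => ((hc t).norm_sq).const_mul m
  have h1 := intervalIntegral.integral_eq_sub_of_hasDerivAt (a := 0) (b := T) (fun t _ => hd t)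
    (Continuous.intervalIntegrable (by fun_prop) _ _)
  have h2 : ∫ t in (0 : ℝ)..T, m ^ 2 * ‖c t‖ ^ 2 ≤
      ∫ t in (0 : ℝ)..T, (‖h t‖ ^ 2 - m * (2 * inner ℝ (c t) (h t - m • c t))) := by
    refine intervalIntegral.integral_mono_on hT (Continuous.intervalIntegrable (by fun_prop) _ _)
      (Continuous.intervalIntegrable (by fun_prop) _ _) fun t _ => ?_
    have := sq_nonneg ‖h t - m • c t‖
    rw [@norm_sub_sq_real, norm_smul, mul_pow, Real.norm_eq_abs, sq_abs, inner_smul_right] at this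
    rw [inner_sub_right, inner_smul_right, real_inner_self_eq_norm_sq, real_inner_comm]
    linarith
  rw [intervalIntegral.integral_sub (Continuous.intervalIntegrable (by fun_prop) _ _)
    (Continuous.intervalIntegrable (by fun_prop) _ _), h1] at h2
  have : 0 ≤ m * ‖c T‖ ^ 2 := by positivity
  linarith

theorem IsResolution.summable_integral {P : ι → H →L[ℝ] H} (hP : IsResolution P)
    {μ : Measure ℝ} {g : ℝ → H} (hg : Integrable (fun t => ‖g t‖ ^ 2) μ)
    (hgm : AEStronglyMeasurable g μ) :
    Summable (fun i => ∫ t, ‖P i (g t)‖ ^ 2 ∂μ) ∧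
      ∑' i, ∫ t, ‖P i (g t)‖ ^ 2 ∂μ ≤ ∫ t, ‖g t‖ ^ 2 ∂μ := by
  have hi : ∀ i, Integrable (fun t => ‖P i (g t)‖ ^ 2) μ := fun i =>
    hg.mono ((((P i).continuous.comp_aestronglyMeasurable hgm).norm).pow 2) <| by
      refine .of_forall fun t => ?_
      simp only [norm_pow, norm_norm]
      gcongr
      exact hP.norm_proj_le i _
  have hb : ∀ F : Finset ι, ∑ i ∈ F, ∫ t, ‖P i (g t)‖ ^ 2 ∂μ ≤ ∫ t, ‖g t‖ ^ 2 ∂μ := fun F => by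
    rw [← integral_finsetSum _ fun i _ => hi i]
    exact integral_mono (integrable_finsetSum _ fun i _ => hi i) hg fun t => hP.sum_norm_sq_le F _
  have h0 : ∀ i, 0 ≤ ∫ t, ‖P i (g t)‖ ^ 2 ∂μ := fun i => integral_nonneg fun t => sq_nonneg _
  exact ⟨summable_of_sum_le h0 hb, Real.tsum_le_of_sum_le h0 hb⟩

/-- Regularity of the solution of the linear equation `u' + A u = g`, where `A` acts as `m i` on
the range of `P i`. -/
theorem IsResolution.linear_regularity [CompleteSpace H] [Countable ι] {P : ι → H →L[ℝ] H}
    (hP : IsResolution P) {m : ι → ℝ} (hm : ∀ i, 0 ≤ m i) {g u : ℝ → H} (hg : Continuous g)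
    {c : ι → ℝ → H} (hc : ∀ i t, HasDerivAt (c i) (P i (g t) - m i • c i t) t)
    (hu : ∀ t, 0 ≤ t → ∀ i, P i (u t) = c i t)
    (h0 : Summable fun i => m i * ‖c i 0‖ ^ 2) {T : ℝ} (hT : 0 ≤ T) :
    ∃ Au : ℝ → H, MemLp Au 2 (volume.restrict (Ioc 0 T)) ∧
      (∀ᵐ t ∂(volume.restrict (Ioc 0 T)), ∀ i, P i (Au t) = m i • P i (u t)) ∧
      (∀ t ∈ Icc 0 T, u t = u 0 + ∫ s in (0 : ℝ)..t, (g s - Au s)) ∧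
      ∀ t ∈ Icc 0 T, HasSum (fun i => m i * ‖c i t‖ ^ 2)
        ((∑' i, m i * ‖c i 0‖ ^ 2) + ∫ s in (0 : ℝ)..t, 2 * inner ℝ (Au s) (g s - Au s)) := by
  have hcc : ∀ i, Continuous (c i) := fun i =>
    continuous_iff_continuousAt.2 fun t => (hc i t).continuousAt
  have hPc : ∀ t, 0 ≤ t → ∀ i, P i (c i t) = c i t := fun t ht i => by
    rw [← hu t ht i, hP.idem]
  set μ : Measure ℝ := volume.restrict (Ioc 0 T) with hμ
  set F : ι → ℝ → ℝ := fun i t => m i ^ 2 * ‖c i t‖ ^ 2 with hF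
  have hF0 : ∀ i t, 0 ≤ F i t := fun i t => by positivity
  have hFc : ∀ i, Continuous (F i) := fun i => by have := hcc i; fun_prop
  have hFi : ∀ i, Integrable (F i) μ := fun i => (hFc i).integrableOn_Ioc
  have hgsq : Integrable (fun t => ‖g t‖ ^ 2) μ := by
    have : Continuous fun t => ‖g t‖ ^ 2 := by fun_prop
    exact this.integrableOn_Ioc
  have hs : Summable fun i => ∫ t, F i t ∂μ := by
    refine Summable.of_nonneg_of_le (fun i => integral_nonneg (hF0 i)) (fun i => ?_)
      (h0.add (hP.summable_integral hgsq hg.aestronglyMeasurable).1)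
    have := integral_sq_le_of_hasDerivAt (hm i) (h := fun t => P i (g t)) (by fun_prop) (hc i) hT
    simpa only [intervalIntegral.integral_of_le hT] using this
  have hlin : ∫⁻ t, ∑' i, ENNReal.ofReal (F i t) ∂μ ≠ ⊤ := by
    rw [lintegral_tsum fun i => (hFc i).measurable.ennreal_ofReal.aemeasurable]
    simp_rw [← fun i => ofReal_integral_eq_lintegral_ofReal (hFi i) (.of_forall (hF0 i))]
    rw [← ENNReal.ofReal_tsum_of_nonneg (fun i => integral_nonneg (hF0 i)) hs]
    exact ENNReal.ofReal_ne_top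
  have hae : ∀ᵐ t ∂μ, Summable fun i => F i t := by
    have := ae_lt_top' (AEMeasurable.tsum fun i =>
      (hFc i).measurable.ennreal_ofReal.aemeasurable) hlin
    filter_upwards [this] with t ht
    have := ENNReal.summable_toReal ht.ne
    simpa only [ENNReal.toReal_ofReal (hF0 _ _)] using this
  have hpos : ∀ᵐ t ∂μ, 0 ≤ t := by
    filter_upwards [ae_restrict_mem measurableSet_Ioc] with t ht using ht.1.le
  have hAus : ∀ᵐ t ∂μ, HasSum (fun i => m i • c i t) (∑' i, m i • c i t) ∧
      ∀ i, P i (∑' i, m i • c i t) = m i • c i t := by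
    filter_upwards [hae, hpos] with t ht h0
    obtain ⟨y, hy, hy'⟩ := hP.exists_of_summable (c := fun i => m i • c i t)
      (fun i => by rw [map_smul, hPc t h0]) (by
        simpa only [norm_smul, mul_pow, Real.norm_eq_abs, sq_abs] using ht)
    rw [hy.tsum_eq]
    exact ⟨hy, hy'⟩
  set Au : ℝ → H := fun t => ∑' i, m i • c i t with hAu
  have hAum : AEStronglyMeasurable Au μ := by
    refine aestronglyMeasurable_of_tendsto_ae (u := (atTop : Filter (Finset ι)))
      (f := fun s t => ∑ i ∈ s, m i • c i t) (fun s => ?_) (hAus.mono fun t ht => ht.1)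
    exact (continuous_finsetSum _ fun i _ => (hcc i).const_smul _).aestronglyMeasurable
  have hAun : ∀ᵐ t ∂μ, HasSum (fun i => F i t) (‖Au t‖ ^ 2) := by
    filter_upwards [hAus] with t ht
    have := hP.hasSum_norm_sq (Au t)
    have hq : ∀ i, P i (Au t) = m i • c i t := ht.2
    simpa only [hq, hF, norm_smul, mul_pow, Real.norm_eq_abs, sq_abs] using this
  have hAuL : MemLp Au 2 μ := by
    rw [memLp_two_iff_integrable_sq_norm hAum]
    refine ⟨hAum.norm.pow 2, ?_⟩
    rw [hasFiniteIntegral_iff_ofReal (.of_forall fun t => sq_nonneg _)]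
    refine lt_of_eq_of_lt (lintegral_congr_ae ?_) hlin.lt_top
    filter_upwards [hAun] with t ht
    rw [← ht.tsum_eq, ENNReal.ofReal_tsum_of_nonneg (fun i => hF0 i t) ht.summable]
  have hfin : IsFiniteMeasure μ := by rw [hμ]; infer_instance
  have hgL : MemLp g 2 μ := by
    rw [memLp_two_iff_integrable_sq_norm hg.aestronglyMeasurable]; exact hgsq
  have hduL : MemLp (fun t => g t - Au t) 2 μ := hgL.sub hAuL
  have hsub : ∀ t ∈ Icc 0 T, volume.restrict (Ioc 0 t) ≤ μ := fun t ht =>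
    Measure.restrict_mono (Ioc_subset_Ioc_right ht.2) le_rfl
  have hduI : ∀ t ∈ Icc 0 T, IntervalIntegrable (fun s => g s - Au s) volume 0 t := fun t ht =>
    (intervalIntegrable_iff_integrableOn_Ioc_of_le ht.1).2
      ((hduL.integrable one_le_two).mono_measure (hsub t ht))
  have hcomp : ∀ᵐ t ∂μ, ∀ i, P i (Au t) = m i • P i (u t) := by
    filter_upwards [hAus, hpos] with t ht h0 i
    rw [ht.2 i, hu t h0]
  refine ⟨Au, hAuL, hcomp, fun t ht => hP.ext fun i => ?_, fun t ht => ?_⟩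
  · rw [map_add, ← (P i).intervalIntegral_comp_comm (hduI t ht), hu t ht.1, hu 0 le_rfl]
    have h1 := intervalIntegral.integral_eq_sub_of_hasDerivAt (a := 0) (b := t)
      (fun t _ => hc i t)
      (Continuous.intervalIntegrable (by have := hcc i; fun_prop) _ _)
    have h2 : ∫ s in (0 : ℝ)..t, P i (g s - Au s) =
        ∫ s in (0 : ℝ)..t, (P i (g s) - m i • c i s) := by
      rw [intervalIntegral.integral_of_le ht.1, intervalIntegral.integral_of_le ht.1]
      refine integral_congr_ae ?_
      filter_upwards [ae_mono (hsub t ht) hAus] with s hs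
      rw [map_sub, hs.2 i]
    rw [h2, h1]
    abel
  · have hE : ∀ i, m i * ‖c i t‖ ^ 2 = m i * ‖c i 0‖ ^ 2 +
        ∫ s in (0 : ℝ)..t, m i * (2 * inner ℝ (c i s) (P i (g s) - m i • c i s)) := fun i => by
      have h1 := intervalIntegral.integral_eq_sub_of_hasDerivAt (a := 0) (b := t)
        (fun t _ => ((hc i t).norm_sq).const_mul (m i))
        (Continuous.intervalIntegrable (by have := hcc i; fun_prop) _ _)
      rw [h1]; ring
    simp_rw [hE]
    refine h0.hasSum.add ?_
    simp_rw [intervalIntegral.integral_of_le ht.1]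
    have hterm : ∀ᵐ s ∂μ, ∀ i, m i * (2 * inner ℝ (c i s) (P i (g s) - m i • c i s)) =
        2 * inner ℝ (P i (Au s)) (P i (g s - Au s)) := by
      filter_upwards [hAus] with s hs i
      rw [map_sub, hs.2 i, inner_smul_left]
      simp only [conj_trivial]
      ring
    have hbi : Integrable (fun s => ‖Au s‖ ^ 2 + ‖g s - Au s‖ ^ 2) (volume.restrict (Ioc 0 t)) :=
      (((memLp_two_iff_integrable_sq_norm hAuL.1).1 hAuL).add
        ((memLp_two_iff_integrable_sq_norm hduL.1).1 hduL)).mono_measure (hsub t ht)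
    set b : ι → ℝ → ℝ := fun i s => ‖P i (Au s)‖ ^ 2 + ‖P i (g s - Au s)‖ ^ 2 with hb
    have hbs : ∀ s, HasSum (fun i => b i s) (‖Au s‖ ^ 2 + ‖g s - Au s‖ ^ 2) := fun s =>
      (hP.hasSum_norm_sq _).add (hP.hasSum_norm_sq _)
    refine hasSum_integral_of_dominated_convergence b (fun i => ?_) (fun i => ?_)
      (.of_forall fun s => (hbs s).summable) ?_ ?_
    · have : Continuous fun s => m i * (2 * inner ℝ (c i s) (P i (g s) - m i • c i s)) := by
        have := hcc i
        fun_prop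
      exact this.aestronglyMeasurable
    · filter_upwards [ae_mono (hsub t ht) hterm] with s hs
      rw [hs i, norm_mul, Real.norm_two]
      have h1 := norm_inner_le_norm (𝕜 := ℝ) (P i (Au s)) (P i (g s - Au s))
      have h2 := two_mul_le_add_sq ‖P i (Au s)‖ ‖P i (g s - Au s)‖
      linarith
    · simpa only [(hbs _).tsum_eq] using hbi
    · filter_upwards [ae_mono (hsub t ht) hterm] with s hs
      simp_rw [hs]
      exact (hP.hasSum_inner _ _).mul_left 2

theorem IsResolution.linear_continuity [CompleteSpace H] [Countable ι] {P : ι → H →L[ℝ] H}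
    (hP : IsResolution P) {m : ι → ℝ} (hm : ∀ i, 0 ≤ m i) {g y : ℝ → H} (hg : Continuous g)
    {c : ι → ℝ → H} (hc : ∀ i t, HasDerivAt (c i) (P i (g t) - m i • c i t) t)
    (hy : ∀ t, 0 ≤ t → ∀ i, P i (y t) = √(1 + m i) • c i t) :
    ContinuousOn y (Ici 0) := by
  have hm1 : ∀ i, 0 < 1 + m i := fun i => by linarith [hm i]
  have hsq : ∀ t, 0 ≤ t → HasSum (fun i => (1 + m i) * ‖c i t‖ ^ 2) (‖y t‖ ^ 2) := fun t ht => by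
    have := hP.hasSum_norm_sq (y t)
    simpa only [hy t ht, norm_smul, mul_pow, Real.norm_eq_abs, sq_abs,
      Real.sq_sqrt (hm1 _).le] using this
  have hPc : ∀ t, 0 ≤ t → ∀ i, P i (c i t) = c i t := fun t ht i => by
    have h := hP.idem i (y t)
    rw [hy t ht, map_smul] at h
    exact smul_right_injective H (Real.sqrt_pos.2 (hm1 i)).ne' h
  have hex : ∀ t, ∃ u, 0 ≤ t → ∀ i, P i u = c i t := fun t => by
    by_cases ht : 0 ≤ t
    · obtain ⟨u, -, hu⟩ := hP.exists_of_summable (hPc t ht) <|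
        (hsq t ht).summable.of_nonneg_of_le (fun i => sq_nonneg _) fun i => by
          nlinarith [hm i, sq_nonneg ‖c i t‖]
      exact ⟨u, fun _ => hu⟩
    · exact ⟨0, fun h => absurd h ht⟩
  choose u hu using hex
  have h0 : Summable fun i => m i * ‖c i 0‖ ^ 2 :=
    (hsq 0 le_rfl).summable.of_nonneg_of_le (fun i => mul_nonneg (hm i) (sq_nonneg _)) fun i => by
      nlinarith [hm i, sq_nonneg ‖c i 0‖]
  intro t ht
  have ht' : (0 : ℝ) ≤ t := ht
  have hT : (0 : ℝ) ≤ t + 1 := by linarith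
  obtain ⟨Au, hAu, -, hint, hE⟩ := hP.linear_regularity hm hg hc hu h0 hT
  set μ : Measure ℝ := volume.restrict (Ioc 0 (t + 1)) with hμ
  have hfin : IsFiniteMeasure μ := by rw [hμ]; infer_instance
  have hgL : MemLp g 2 μ := by
    have : Continuous fun t => ‖g t‖ ^ 2 := by fun_prop
    exact (memLp_two_iff_integrable_sq_norm hg.aestronglyMeasurable).2 this.integrableOn_Ioc
  have hdu : MemLp (fun t => g t - Au t) 2 μ := hgL.sub hAu
  have hcu : ContinuousOn u (Icc 0 (t + 1)) := by
    refine ContinuousOn.congr (continuousOn_const.add ?_) hint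
    have := intervalIntegral.continuousOn_primitive_interval' (a := 0) (b₁ := 0) (b₂ := t + 1)
      ((intervalIntegrable_iff_integrableOn_Ioc_of_le hT).2 (hdu.integrable one_le_two))
      left_mem_uIcc
    rwa [uIcc_of_le hT] at this
  have hI : Integrable (fun s => 2 * inner ℝ (Au s) (g s - Au s)) μ :=
    (memLp_one_iff_integrable.1 (hAu.of_bilin (r := 1) (p := 2) (q := 2) (inner ℝ) 1 hdu
      (hAu.1.inner hdu.1) (.of_forall fun s => by
        simpa using nnnorm_inner_le_nnnorm (𝕜 := ℝ) (Au s) (g s - Au s)))).const_mul 2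
  have hcE : ContinuousOn (fun t => ‖u t‖ ^ 2 + ((∑' i, m i * ‖c i 0‖ ^ 2) +
      ∫ s in (0 : ℝ)..t, 2 * inner ℝ (Au s) (g s - Au s))) (Icc 0 (t + 1)) := by
    refine (hcu.norm.pow 2).add (continuousOn_const.add ?_)
    have := intervalIntegral.continuousOn_primitive_interval' (a := 0) (b₁ := 0) (b₂ := t + 1)
      ((intervalIntegrable_iff_integrableOn_Ioc_of_le hT).2 hI) left_mem_uIcc
    rwa [uIcc_of_le hT] at this
  have hcn : ContinuousOn (fun t => ‖y t‖ ^ 2) (Icc 0 (t + 1)) := by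
    refine hcE.congr fun s hs => ?_
    refine (hsq s hs.1).unique ?_
    have := (hP.hasSum_norm_sq (u s)).add (hE s hs)
    simp_rw [hu s hs.1] at this
    simpa only [add_mul, one_mul] using this
  have hnhds : 𝓝[Icc 0 (t + 1)] t = 𝓝[Ici 0] t := by
    rw [← Ici_inter_Iic]
    exact nhdsWithin_inter_of_mem' (mem_nhdsWithin_of_mem_nhds (Iic_mem_nhds (by linarith)))
  refine hP.tendsto_of_proj (fun i => ?_) ?_
  · have : ContinuousWithinAt (fun s => √(1 + m i) • c i s) (Ici 0) t :=
      ((hc i t).continuousAt.const_smul _).continuousWithinAt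
    exact this.congr (fun s hs => hy s hs i) (hy t ht i)
  · have := hcn t ⟨ht', by linarith⟩
    rwa [ContinuousWithinAt, hnhds] at this

end FastSolutions

namespace FastSolutions

variable {H : Type*} [NormedAddCommGroup H] [InnerProductSpace ℝ H] {ι : Type*}

/-- The Cauchy–Schwarz inequality for a vector valued integral. -/
theorem norm_integral_smul_sq_le {α : Type*} [MeasurableSpace α] {μ : Measure α} {φ : α → ℝ}
    {h : α → H} (hφ : MemLp φ 2 μ) (hh : MemLp h 2 μ) :
    ‖∫ a, φ a • h a ∂μ‖ ^ 2 ≤ (∫ a, φ a ^ 2 ∂μ) * ∫ a, ‖h a‖ ^ 2 ∂μ := by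
  have h1 : ‖∫ a, φ a • h a ∂μ‖ ≤ ∫ a, ‖φ a‖ * ‖h a‖ ∂μ := by
    simpa only [norm_smul] using norm_integral_le_integral_norm (fun a => φ a • h a) (μ := μ)
  have h2 := integral_mul_norm_le_Lp_mul_Lq (μ := μ) (f := φ) (g := fun a => ‖h a‖) (p := 2) (q := 2)
    (by constructor <;> norm_num) (by simpa using hφ) (by simpa using hh.norm)
  simp only [norm_norm, Real.rpow_ofNat, ← Real.sqrt_eq_rpow] at h1 h2
  have h3 := h1.trans h2
  calc _ ≤ (√(∫ a, ‖φ a‖ ^ 2 ∂μ) * √(∫ a, ‖h a‖ ^ 2 ∂μ)) ^ 2 := by gcongr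
    _ = _ := by
      rw [mul_pow, Real.sq_sqrt (integral_nonneg fun _ => sq_nonneg _),
        Real.sq_sqrt (integral_nonneg fun _ => sq_nonneg _)]
      simp only [Real.norm_eq_abs, sq_abs]

/-- The solution of `c' = h - m c` with `c 0 = a`. -/
noncomputable def duhamel (m : ℝ) (a : H) (h : ℝ → H) (t : ℝ) : H :=
  Real.exp (-m * t) • (a + ∫ s in (0 : ℝ)..t, Real.exp (m * s) • h s)

theorem hasDerivAt_duhamel [CompleteSpace H] (m : ℝ) (a : H) {h : ℝ → H} (hh : Continuous h)
    (t : ℝ) : HasDerivAt (duhamel m a h) (h t - m • duhamel m a h t) t := by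
  have h1 : HasDerivAt (fun t => Real.exp (-m * t)) (Real.exp (-m * t) * -m) t := by
    simpa using ((hasDerivAt_id t).const_mul (-m)).exp
  have hcont : Continuous fun s => Real.exp (m * s) • h s := by fun_prop
  have h2 : HasDerivAt (fun t => a + ∫ s in (0 : ℝ)..t, Real.exp (m * s) • h s)
      (Real.exp (m * t) • h t) t :=
    (hcont.integral_hasStrictDerivAt 0 t).hasDerivAt.const_add a
  refine (h1.smul h2).congr_deriv ?_
  rw [smul_smul, ← Real.exp_add, duhamel]
  simp only [neg_mul, neg_add_cancel, Real.exp_zero, one_smul, smul_smul]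
  rw [mul_neg, neg_smul, mul_comm (Real.exp _) m, ← sub_eq_add_neg]

theorem duhamel_add_const (m : ℝ) (a b : H) (h : ℝ → H) (t : ℝ) :
    duhamel m (a + b) h t = Real.exp (-m * t) • a + duhamel m b h t := by
  simp only [duhamel, smul_add]; abel

/-- The initial value of the solution of `c' = h - m c` which decays faster than `exp (-κ t)`,
when `m < κ`. -/
noncomputable def decayInit (m κ : ℝ) (h : ℝ → H) : H :=
  open Classical in if m < κ then -∫ s in Ioi (0 : ℝ), Real.exp (m * s) • h s else 0

/-- The solution of `c' = h - m c` with weighted decay, and with zero initial value if `κ ≤ m`. -/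
noncomputable def decaySol (m κ : ℝ) (h : ℝ → H) : ℝ → H :=
  duhamel m (decayInit m κ h) h

section Estimate

variable {m κ : ℝ} {h : ℝ → H}

theorem exp_smul_eq (m κ s : ℝ) (h : ℝ → H) :
    Real.exp (m * s) • h s = Real.exp ((m - κ) * s) • Real.exp (κ * s) • h s := by
  rw [smul_smul, ← Real.exp_add]; ring_nf

theorem memLp_exp_Ioi (h : m < 0) (t : ℝ) :
    MemLp (fun s => Real.exp (m * s)) 2 (volume.restrict (Ioi t)) := by
  rw [memLp_two_iff_integrable_sq (by fun_prop)]
  have := integrableOn_exp_mul_Ioi (a := 2 * m) (by linarith) t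
  refine this.congr (.of_forall fun s => ?_)
  simp only [← Real.exp_nat_mul]; push_cast; ring_nf

theorem integrableOn_exp_smul (hmκ : m < κ)
    (hh : MemLp (fun s => Real.exp (κ * s) • h s) 2 (volume.restrict (Ioi 0))) :
    IntegrableOn (fun s => Real.exp (m * s) • h s) (Ioi 0) := by
  simp_rw [exp_smul_eq m κ]
  exact memLp_one_iff_integrable.1 (hh.smul (memLp_exp_Ioi (by linarith) 0))

theorem norm_decaySol_sq_le (hmκ : m ≠ κ)
    (hh : MemLp (fun s => Real.exp (κ * s) • h s) 2 (volume.restrict (Ioi 0))) {t : ℝ}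
    (ht : 0 ≤ t) :
    ‖decaySol m κ h t‖ ^ 2 ≤ Real.exp (-2 * κ * t) / (2 * |m - κ|) *
      ∫ s in Ioi (0 : ℝ), ‖Real.exp (κ * s) • h s‖ ^ 2 := by
  obtain ⟨S, hSm, hS, hSφ, hSeq, hSint⟩ : ∃ S : Set ℝ, MeasurableSet S ∧ S ⊆ Ioi 0 ∧
      MemLp (fun s => Real.exp ((m - κ) * s)) 2 (volume.restrict S) ∧
      ‖decaySol m κ h t‖ = Real.exp (-m * t) * ‖∫ s in S, Real.exp (m * s) • h s‖ ∧
      ∫ s in S, Real.exp ((m - κ) * s) ^ 2 ≤ Real.exp (2 * (m - κ) * t) / (2 * |m - κ|) := by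
    have hsq : ∀ s, Real.exp ((m - κ) * s) ^ 2 = Real.exp (2 * (m - κ) * s) := fun s => by
      rw [← Real.exp_nat_mul]; push_cast; ring_nf
    rcases lt_or_gt_of_ne hmκ with hlt | hgt
    · refine ⟨Ioi t, measurableSet_Ioi, Ioi_subset_Ioi ht, memLp_exp_Ioi (by linarith) t, ?_, ?_⟩
      · have hi := integrableOn_exp_smul hlt hh
        have := intervalIntegral.integral_interval_add_Ioi (a := 0) (b := t) hi
          (hi.mono_set (Ioi_subset_Ioi ht))
        rw [decaySol, duhamel, norm_smul, Real.norm_eq_abs, Real.abs_exp, decayInit, if_pos hlt,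
          ← this]
        congr 1
        rw [neg_add, neg_add_cancel_comm, norm_neg]
      · simp_rw [hsq]
        rw [integral_exp_mul_Ioi (by linarith), abs_of_neg (by linarith)]
        refine le_of_eq ?_
        rw [mul_neg, div_neg, neg_div]
    · refine ⟨Ioc 0 t, measurableSet_Ioc, Ioc_subset_Ioi_self, ?_, ?_, ?_⟩
      · rw [memLp_two_iff_integrable_sq (by fun_prop)]
        have : Continuous fun s => Real.exp ((m - κ) * s) ^ 2 := by fun_prop
        exact this.integrableOn_Ioc
      · rw [decaySol, duhamel, norm_smul, Real.norm_eq_abs, Real.abs_exp, decayInit,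
          if_neg hgt.not_gt, zero_add, intervalIntegral.integral_of_le ht]
      · simp_rw [hsq]
        have hpos : 0 < 2 * (m - κ) := by linarith
        rw [abs_of_pos (by linarith), ← integral_exp_mul_Iic hpos]
        exact setIntegral_mono_set (integrableOn_exp_mul_Iic hpos t)
          (.of_forall fun _ => (Real.exp_pos _).le)
          (LE.le.eventuallyLE Ioc_subset_Iic_self)
  have h1 := norm_integral_smul_sq_le hSφ (hh.mono_measure (Measure.restrict_mono hS le_rfl))
  simp_rw [← exp_smul_eq] at h1
  have h2 : ∫ s in S, ‖Real.exp (κ * s) • h s‖ ^ 2 ≤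
      ∫ s in Ioi (0 : ℝ), ‖Real.exp (κ * s) • h s‖ ^ 2 :=
    setIntegral_mono_set ((memLp_two_iff_integrable_sq_norm hh.1).1 hh)
      (.of_forall fun _ => sq_nonneg _) (LE.le.eventuallyLE hS)
  rw [hSeq, mul_pow]
  calc _ ≤ Real.exp (-m * t) ^ 2 * (Real.exp (2 * (m - κ) * t) / (2 * |m - κ|) *
        ∫ s in Ioi (0 : ℝ), ‖Real.exp (κ * s) • h s‖ ^ 2) := by
        gcongr
        exact h1.trans (mul_le_mul hSint h2 (integral_nonneg fun _ => sq_nonneg _)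
          (by positivity))
    _ = _ := by
      rw [← mul_assoc, ← mul_div_assoc, ← Real.exp_nat_mul, ← Real.exp_add]
      push_cast
      ring_nf

theorem decaySol_sub {h k : ℝ → H} (hc : Continuous h) (kc : Continuous k)
    (hh : MemLp (fun s => Real.exp (κ * s) • h s) 2 (volume.restrict (Ioi 0)))
    (kk : MemLp (fun s => Real.exp (κ * s) • k s) 2 (volume.restrict (Ioi 0))) (t : ℝ) :
    decaySol m κ (fun s => h s - k s) t = decaySol m κ h t - decaySol m κ k t := by
  have h1 : decayInit m κ (fun s => h s - k s) = decayInit m κ h - decayInit m κ k := by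
    unfold decayInit
    split_ifs with hlt
    · simp_rw [smul_sub]
      rw [integral_sub (integrableOn_exp_smul hlt hh) (integrableOn_exp_smul hlt kk)]
      abel
    · simp
  have hci : ∀ {h : ℝ → H}, Continuous h →
      IntervalIntegrable (fun s => Real.exp (m * s) • h s) volume 0 t := fun hc =>
    Continuous.intervalIntegrable (by fun_prop) _ _
  simp only [decaySol, duhamel, h1, smul_sub]
  rw [intervalIntegral.integral_sub (hci hc) (hci kc), ← smul_sub]
  congr 1
  abel

theorem map_decaySol [CompleteSpace H] (Q : H →L[ℝ] H) (hc : Continuous h)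
    (hh : MemLp (fun s => Real.exp (κ * s) • h s) 2 (volume.restrict (Ioi 0))) (t : ℝ) :
    Q (decaySol m κ h t) = decaySol m κ (fun s => Q (h s)) t := by
  have h1 : Q (decayInit m κ h) = decayInit m κ fun s => Q (h s) := by
    unfold decayInit
    split_ifs with hlt
    · rw [map_neg, ← Q.integral_comp_comm (integrableOn_exp_smul hlt hh)]
      simp only [map_smul]
    · simp
  rw [decaySol, decaySol, duhamel, duhamel, map_smul, map_add, h1,
    ← Q.intervalIntegral_comp_comm (Continuous.intervalIntegrable (by fun_prop) _ _)]
  simp only [map_smul]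

end Estimate

theorem memLp_exp_smul {κ q M : ℝ} (hκq : κ < q) {g : ℝ → H} (hg : Continuous g)
    (hb : ∀ t, 0 ≤ t → ‖g t‖ ≤ M * Real.exp (-q * t)) :
    MemLp (fun s => Real.exp (κ * s) • g s) 2 (volume.restrict (Ioi 0)) ∧
      ∫ s in Ioi (0 : ℝ), ‖Real.exp (κ * s) • g s‖ ^ 2 ≤ M ^ 2 / (2 * (q - κ)) := by
  have hm : AEStronglyMeasurable (fun s => Real.exp (κ * s) • g s) (volume.restrict (Ioi 0)) := by
    have : Continuous fun s => Real.exp (κ * s) • g s := by fun_prop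
    exact this.aestronglyMeasurable
  have hI : IntegrableOn (fun s => M ^ 2 * Real.exp (2 * (κ - q) * s)) (Ioi 0) :=
    (integrableOn_exp_mul_Ioi (by linarith) 0).const_mul _
  have hle : ∀ s ∈ Ioi (0 : ℝ), ‖Real.exp (κ * s) • g s‖ ^ 2 ≤
      M ^ 2 * Real.exp (2 * (κ - q) * s) := fun s hs => by
    calc _ ≤ (Real.exp (κ * s) * (M * Real.exp (-q * s))) ^ 2 := by
          rw [norm_smul, Real.norm_eq_abs, Real.abs_exp]
          gcongr
          exact hb s (le_of_lt hs)
      _ = _ := by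
          rw [mul_left_comm, ← Real.exp_add, mul_pow, ← Real.exp_nat_mul]
          push_cast
          ring_nf
  have hint : IntegrableOn (fun s => ‖Real.exp (κ * s) • g s‖ ^ 2) (Ioi 0) := by
    refine Integrable.mono' hI (hm.norm.pow 2) ?_
    filter_upwards [ae_restrict_mem measurableSet_Ioi] with s hs
    simpa only [norm_pow, norm_norm] using hle s hs
  refine ⟨(memLp_two_iff_integrable_sq_norm hm).2 hint, ?_⟩
  calc _ ≤ ∫ s in Ioi (0 : ℝ), M ^ 2 * Real.exp (2 * (κ - q) * s) :=
        setIntegral_mono_on hint hI measurableSet_Ioi hle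
    _ = _ := by
      rw [integral_const_mul, integral_exp_mul_Ioi (by linarith), mul_zero, Real.exp_zero,
        ← neg_div_neg_eq, neg_neg, ← mul_div_assoc, mul_one]
      congr 1
      ring

/-- The square of the constant in the weighted estimate of `IsResolution.exists_decaySol`. -/
noncomputable def decayConst (κ q δ : ℝ) : ℝ :=
  (1 + (1 + κ) / δ) / 2 / (2 * (q - κ))

theorem IsResolution.exists_decaySol [CompleteSpace H] {P : ι → H →L[ℝ] H}
    (hP : IsResolution P) {m : ι → ℝ} (hm : ∀ i, 0 ≤ m i) {κ q δ M : ℝ} (hκ : 0 ≤ κ)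
    (hκq : κ < q) (hδ : 0 < δ) (hgap : ∀ i, δ ≤ |m i - κ|) {g : ℝ → H} (hg : Continuous g)
    (hM : 0 ≤ M) (hb : ∀ t, 0 ≤ t → ‖g t‖ ≤ M * Real.exp (-q * t)) {t : ℝ} (ht : 0 ≤ t) :
    ∃ y, (∀ i, P i y = √(1 + m i) • decaySol (m i) κ (fun s => P i (g s)) t) ∧
      ‖y‖ ≤ √(decayConst κ q δ) * M * Real.exp (-κ * t) := by
  obtain ⟨hL, hLb⟩ := memLp_exp_smul hκq hg hb
  have hLm := hL.1
  have hLi := (memLp_two_iff_integrable_sq_norm hLm).1 hL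
  obtain ⟨hs, hsb⟩ := hP.summable_integral hLi hLm
  set D : ι → H := fun i => decaySol (m i) κ (fun s => P i (g s)) t with hD
  have hPL : ∀ i, MemLp (fun s => Real.exp (κ * s) • P i (g s)) 2 (volume.restrict (Ioi 0)) :=
    fun i => by
    simpa only [Function.comp_def, map_smul] using (P i).comp_memLp' hL
  have hPD : ∀ i, P i (D i) = D i := fun i => by
    rw [hD]
    simp only
    rw [map_decaySol _ (by fun_prop) (hPL i)]
    simp only [hP.idem]
  have hm1 : ∀ i, 0 < 1 + m i := fun i => by linarith [hm i]
  set K := (1 + (1 + κ) / δ) / 2 * Real.exp (-2 * κ * t) with hK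
  have hK0 : 0 ≤ K := by positivity
  have hbd : ∀ i, ‖√(1 + m i) • D i‖ ^ 2 ≤
      K * ∫ s in Ioi (0 : ℝ), ‖P i (Real.exp (κ * s) • g s)‖ ^ 2 := fun i => by
    have hx : 0 < |m i - κ| := hδ.trans_le (hgap i)
    have h1 := norm_decaySol_sq_le (m := m i) (κ := κ)
      (fun h => by rw [h, sub_self, abs_zero] at hx; exact hx.false) (hPL i) ht
    simp only [map_smul]
    have h2 : (1 + m i) / (2 * |m i - κ|) ≤ (1 + (1 + κ) / δ) / 2 := by
      rw [div_le_div_iff₀ (by positivity) two_pos]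
      have h3 : 1 + κ ≤ (1 + κ) / δ * |m i - κ| := by
        rw [div_mul_eq_mul_div, le_div_iff₀ hδ]
        exact mul_le_mul_of_nonneg_left (hgap i) (by linarith)
      nlinarith [le_abs_self (m i - κ)]
    rw [norm_smul, mul_pow, Real.norm_eq_abs, sq_abs, Real.sq_sqrt (hm1 i).le]
    set I := ∫ s in Ioi (0 : ℝ), ‖Real.exp (κ * s) • P i (g s)‖ ^ 2
    have hI : 0 ≤ I := integral_nonneg fun _ => sq_nonneg _
    calc _ ≤ (1 + m i) * (Real.exp (-2 * κ * t) / (2 * |m i - κ|) * I) := by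
          have := hm1 i
          gcongr
      _ = (1 + m i) / (2 * |m i - κ|) * (Real.exp (-2 * κ * t) * I) := by ring
      _ ≤ (1 + (1 + κ) / δ) / 2 * (Real.exp (-2 * κ * t) * I) := by gcongr
      _ = K * I := by rw [hK]; ring
  have hsum : Summable fun i => ‖√(1 + m i) • D i‖ ^ 2 :=
    (hs.mul_left K).of_nonneg_of_le (fun _ => sq_nonneg _) hbd
  obtain ⟨y, -, hy⟩ := hP.exists_of_summable (fun i => by rw [map_smul, hPD]) hsum
  refine ⟨y, hy, abs_le_of_sq_le_sq' ?_ (by positivity) |>.2⟩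
  have hn := hP.hasSum_norm_sq y
  simp_rw [hy] at hn
  have hC : 0 ≤ decayConst κ q δ := by
    have : 0 < q - κ := by linarith
    unfold decayConst
    positivity
  calc ‖y‖ ^ 2 ≤ K * (M ^ 2 / (2 * (q - κ))) := by
        rw [← hn.tsum_eq]
        refine (hsum.tsum_le_tsum hbd (hs.mul_left K)).trans ?_
        rw [tsum_mul_left]
        exact mul_le_mul_of_nonneg_left (hsb.trans hLb) hK0
    _ = _ := by
      rw [mul_pow, mul_pow, Real.sq_sqrt hC, ← Real.exp_nat_mul, hK, decayConst]
      push_cast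
      ring_nf

end FastSolutions

namespace FastSolutions

open scoped NNReal BoundedContinuousFunction

variable {H : Type*} [NormedAddCommGroup H] [InnerProductSpace ℝ H] {ι : Type*}

theorem IsResolution.exists_of_norm_le [CompleteSpace H] {P : ι → H →L[ℝ] H}
    (hP : IsResolution P) {c : ι → H} (hc : ∀ i, P i (c i) = c i) {k : ℝ} (hk : 0 ≤ k) {x : H}
    (hb : ∀ i, ‖c i‖ ≤ k * ‖P i x‖) : ∃ y, (∀ i, P i y = c i) ∧ ‖y‖ ≤ k * ‖x‖ := by
  have hsq : ∀ i, ‖c i‖ ^ 2 ≤ k ^ 2 * ‖P i x‖ ^ 2 := fun i => by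
    rw [← mul_pow]
    exact pow_le_pow_left₀ (norm_nonneg _) (hb i) 2
  have hx := (hP.hasSum_norm_sq x).mul_left (k ^ 2)
  obtain ⟨y, -, hy⟩ := hP.exists_of_summable hc
    (hx.summable.of_nonneg_of_le (fun _ => sq_nonneg _) hsq)
  refine ⟨y, hy, abs_le_of_sq_le_sq' ?_ (by positivity) |>.2⟩
  rw [mul_pow]
  refine hasSum_le (fun i => ?_) (hP.hasSum_norm_sq y) hx
  rw [hy i]
  exact hsq i

/-- The component of the solution of the linear equation selected by its behaviour at infinity. -/
noncomputable def linComp (m κ : ℝ) (a : H) (h : ℝ → H) : ℝ → H :=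
  duhamel m ((√(1 + m))⁻¹ • a + decayInit m κ h) h

theorem sqrt_smul_linComp {m : ℝ} (hm : 0 ≤ m) (κ : ℝ) (a : H) (h : ℝ → H) (t : ℝ) :
    √(1 + m) • linComp m κ a h t =
      Real.exp (-m * t) • a + √(1 + m) • decaySol m κ h t := by
  have : √(1 + m) ≠ 0 := (Real.sqrt_pos.2 (by linarith)).ne'
  rw [linComp, duhamel_add_const, smul_add, decaySol, smul_comm, smul_inv_smul₀ this]

theorem IsResolution.exists_linear_decaying [CompleteSpace H] [Countable ι] {P : ι → H →L[ℝ] H}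
    (hP : IsResolution P) {m : ι → ℝ} (hm : ∀ i, 0 ≤ m i) {lam κ q δ M : ℝ} (hlam : 0 < lam)
    (hκ : κ = lam + δ) (hκq : κ < q) (hδ : 0 < δ) (hgap : ∀ i, m i ≤ lam ∨ κ + δ ≤ m i)
    {g : ℝ → H} (hg : Continuous g) (hM : 0 ≤ M)
    (hb : ∀ t, 0 ≤ t → ‖g t‖ ≤ M * Real.exp (-q * t)) {a b : H}
    (ha0 : ∀ i, m i ≠ lam → P i a = 0) (hb0 : ∀ i, m i ≤ lam → P i b = 0) :
    ∃ z : ℝ≥0 →ᵇ H, (∀ (t : ℝ≥0) i, P i (z t) = Real.exp (lam * t) • √(1 + m i) •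
        linComp (m i) κ (P i (a + b)) (fun s => P i (g s)) t) ∧
      ‖z‖ ≤ ‖a + b‖ + √(decayConst κ q δ) * M ∧
      ∀ t : ℝ≥0, ‖z t - a‖ ≤ Real.exp (-δ * t) * (‖b‖ + √(decayConst κ q δ) * M) := by
  set C := √(decayConst κ q δ) with hC
  have hC0 : 0 ≤ C := Real.sqrt_nonneg _
  have hgap' : ∀ i, δ ≤ |m i - κ| := fun i => by
    rcases hgap i with h | h
    · rw [abs_sub_comm]; exact (by linarith : δ ≤ κ - m i).trans (le_abs_self _)
    · exact (by linarith : δ ≤ m i - κ).trans (le_abs_self _)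
  have hlow : ∀ i, m i < lam → P i (a + b) = 0 := fun i hi => by
    rw [map_add, ha0 i hi.ne, hb0 i hi.le, add_zero]
  have hA : ∀ t : ℝ, 0 ≤ t → ∃ y, (∀ i, P i y = Real.exp (-m i * t) • P i (a + b)) ∧
      ‖y‖ ≤ Real.exp (-lam * t) * ‖a + b‖ := fun t ht => by
    refine hP.exists_of_norm_le (fun i => by rw [map_smul, hP.idem]) (Real.exp_pos _).le
      fun i => ?_
    rcases lt_or_ge (m i) lam with h | h
    · simp [hlow i h]
    · rw [norm_smul, Real.norm_eq_abs, Real.abs_exp]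
      gcongr
  have hD := fun (t : ℝ) (ht : 0 ≤ t) =>
    hP.exists_decaySol hm (κ := κ) (by linarith) hκq hδ hgap' hg hM hb ht
  have hY : ∀ t : ℝ, ∃ y, 0 ≤ t → (∀ i, P i y = √(1 + m i) •
      linComp (m i) κ (P i (a + b)) (fun s => P i (g s)) t) ∧
      ‖y‖ ≤ Real.exp (-lam * t) * (‖a + b‖ + C * M) ∧
      ‖Real.exp (lam * t) • y - a‖ ≤ Real.exp (-δ * t) * (‖b‖ + C * M) := fun t => by
    by_cases ht : 0 ≤ t
    swap
    · exact ⟨0, fun h => absurd h ht⟩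
    obtain ⟨y₁, h1, h1'⟩ := hA t ht
    obtain ⟨y₂, h2, h2'⟩ := hD t ht
    have hexp : Real.exp (-κ * t) = Real.exp (-lam * t) * Real.exp (-δ * t) := by
      rw [← Real.exp_add, hκ]; ring_nf
    have hδ1 : Real.exp (-δ * t) ≤ 1 := Real.exp_le_one_iff.2 (by nlinarith)
    refine ⟨y₁ + y₂, fun _ => ⟨fun i => ?_, ?_, ?_⟩⟩
    · rw [sqrt_smul_linComp (hm i), map_add, h1, h2]
    · have h3 : ‖y₂‖ ≤ Real.exp (-lam * t) * (C * M) := by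
        calc ‖y₂‖ ≤ Real.exp (-lam * t) * (C * M) * Real.exp (-δ * t) := by
              rw [hexp] at h2'; linarith
          _ ≤ _ := mul_le_of_le_one_right (by positivity) hδ1
      linarith [norm_add_le y₁ y₂]
    · obtain ⟨y₃, h3, h3'⟩ := hP.exists_of_norm_le (x := b)
        (c := fun i => (Real.exp (lam * t) * Real.exp (-m i * t)) • P i (a + b) - P i a)
        (fun i => by simp only [map_sub, map_smul, hP.idem]) (Real.exp_pos (-δ * t)).le
        fun i => by
          rcases hgap i with h | h
          · rcases h.lt_or_eq with h' | h'
            · simp [hlow i h', ha0 i h'.ne]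
              positivity
            · rw [← Real.exp_add, h', map_add, hb0 i h, ← add_mul, add_neg_cancel]
              simp
          · rw [map_add, ha0 i (by linarith), zero_add, sub_zero, norm_smul, ← Real.exp_add,
              Real.norm_eq_abs, Real.abs_exp]
            gcongr
            nlinarith
      have h4 : Real.exp (lam * t) • (y₁ + y₂) - a = y₃ + Real.exp (lam * t) • y₂ := by
        have : y₃ = Real.exp (lam * t) • y₁ - a := hP.ext fun i => by
          rw [h3, map_sub, map_smul, h1, smul_smul]
        rw [this, smul_add]; abel
      have h5 : ‖Real.exp (lam * t) • y₂‖ ≤ Real.exp (-δ * t) * (C * M) := by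
        rw [norm_smul, Real.norm_eq_abs, Real.abs_exp]
        calc _ ≤ Real.exp (lam * t) * (C * M * Real.exp (-κ * t)) := by gcongr
          _ = _ := by
            rw [hexp, neg_mul lam, Real.exp_neg]
            field_simp
      rw [h4]
      linarith [norm_add_le y₃ (Real.exp (lam * t) • y₂)]
  choose y hy using hY
  have hcont : ContinuousOn y (Ici 0) := hP.linear_continuity hm hg
    (c := fun i => linComp (m i) κ (P i (a + b)) fun s => P i (g s))
    (fun i t => hasDerivAt_duhamel _ _ (by fun_prop) t) fun t ht => (hy t ht).1
  have hcont' : Continuous fun t : ℝ≥0 => Real.exp (lam * t) • y t :=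
    Continuous.smul (by fun_prop) (hcont.comp_continuous NNReal.continuous_coe fun t => t.2)
  have hbd : ∀ t : ℝ≥0, ‖Real.exp (lam * t) • y t‖ ≤ ‖a + b‖ + C * M := fun t => by
    rw [norm_smul, Real.norm_eq_abs, Real.abs_exp]
    calc _ ≤ Real.exp (lam * t) * (Real.exp (-lam * t) * (‖a + b‖ + C * M)) := by
          gcongr
          exact (hy t t.2).2.1
      _ = _ := by
        rw [neg_mul, Real.exp_neg]
        field_simp
  refine ⟨BoundedContinuousFunction.ofNormedAddCommGroup _ hcont' _ hbd, fun t i => ?_,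
    BoundedContinuousFunction.norm_ofNormedAddCommGroup_le hcont' (by positivity) hbd,
    fun t => (hy t t.2).2.2⟩
  rw [BoundedContinuousFunction.coe_ofNormedAddCommGroup, map_smul, (hy t t.2).1]

end FastSolutions

namespace FastSolutions

open scoped NNReal BoundedContinuousFunction

variable {H : Type*} [NormedAddCommGroup H] [InnerProductSpace ℝ H] {ι : Type*}

/-- The function on the line, constant on the negative half-line, which equals
`exp (-lam t) x(t)` for `t ≥ 0`. -/
noncomputable def unweight (lam : ℝ) (x : ℝ≥0 →ᵇ H) (t : ℝ) : H :=
  Real.exp (-lam * t.toNNReal) • x t.toNNReal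

theorem continuous_unweight (lam : ℝ) (x : ℝ≥0 →ᵇ H) : Continuous (unweight lam x) := by
  unfold unweight
  have := continuous_real_toNNReal
  fun_prop

theorem unweight_of_nonneg (lam : ℝ) (x : ℝ≥0 →ᵇ H) {t : ℝ} (ht : 0 ≤ t) :
    unweight lam x t = Real.exp (-lam * t) • x t.toNNReal := by
  rw [unweight, Real.coe_toNNReal t ht]

theorem norm_unweight_le {lam : ℝ} (x : ℝ≥0 →ᵇ H) {t : ℝ} :
    ‖unweight lam x t‖ ≤ Real.exp (-lam * t.toNNReal) * ‖x‖ := by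
  rw [unweight, norm_smul, Real.norm_eq_abs, Real.abs_exp]
  gcongr
  exact x.norm_coe_le_norm _

theorem norm_unweight_le' {lam : ℝ} (hlam : 0 ≤ lam) (x : ℝ≥0 →ᵇ H) {t : ℝ} :
    ‖unweight lam x t‖ ≤ ‖x‖ := by
  refine (norm_unweight_le x).trans (mul_le_of_le_one_left (norm_nonneg _) ?_)
  refine Real.exp_le_one_iff.2 ?_
  have := t.toNNReal.2
  nlinarith

theorem unweight_sub (lam : ℝ) (x y : ℝ≥0 →ᵇ H) (t : ℝ) :
    unweight lam (x - y) t = unweight lam x t - unweight lam y t := by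
  simp [unweight, smul_sub]

theorem linComp_sub {m κ : ℝ} (a : H) {h k : ℝ → H} (hc : Continuous h) (kc : Continuous k)
    (hh : MemLp (fun s => Real.exp (κ * s) • h s) 2 (volume.restrict (Ioi 0)))
    (kk : MemLp (fun s => Real.exp (κ * s) • k s) 2 (volume.restrict (Ioi 0))) (t : ℝ) :
    linComp m κ a h t - linComp m κ a k t = decaySol m κ (fun s => h s - k s) t := by
  rw [decaySol_sub hc kc hh kk, linComp, linComp, duhamel_add_const, duhamel_add_const,
    decaySol, decaySol]
  abel

theorem exists_radius {R p : ℝ} (hR : 0 < R) (hp : 0 < p) (K : ℝ) :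
    ∃ ρ, 0 < ρ ∧ ρ < R ∧ K * ρ ^ p ≤ 1 / 2 := by
  have h : Tendsto (fun ρ : ℝ => K * ρ ^ p) (𝓝[>] 0) (𝓝 0) := by
    have : Continuous fun ρ : ℝ => K * ρ ^ p := by fun_prop (disch := positivity)
    have := this.tendsto 0
    rw [Real.zero_rpow hp.ne', mul_zero] at this
    exact this.mono_left nhdsWithin_le_nhds
  have h1 := h.eventually_lt_const (show (0 : ℝ) < 1 / 2 by norm_num)
  have h2 : ∀ᶠ ρ in 𝓝[>] (0 : ℝ), ρ ∈ Ioo 0 R := Ioo_mem_nhdsGT hR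
  obtain ⟨ρ, hρ, hρ'⟩ := (h1.and h2).exists
  exact ⟨ρ, hρ'.1, hρ'.2, hρ.le⟩

/-- Existence of a solution of the nonlinear equation with prescribed asymptotic behaviour. The
unknown `y` stands for `(1 + A)^{1/2} u`, and `N y = f u`. -/
theorem IsResolution.exists_decaying [CompleteSpace H] [Countable ι] {P : ι → H →L[ℝ] H}
    (hP : IsResolution P) {m : ι → ℝ} (hm : ∀ i, 0 ≤ m i) {R p L : ℝ} (hR : 0 < R) (hp : 0 < p)
    (hL : 0 ≤ L) {N : H → H}
    (hN : ∀ y z, ‖y‖ < R → ‖z‖ < R → ‖N y - N z‖ ≤ L * (‖y‖ ^ p + ‖z‖ ^ p) * ‖y - z‖)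
    (hN0 : N 0 = 0) {lam ε : ℝ} (hlam : 0 < lam) (hε : 0 < ε)
    (hgap : ∀ i, m i ≤ lam ∨ lam + ε ≤ m i) :
    ∃ r₀ > 0, ∀ a b : H, (∀ i, m i ≠ lam → P i a = 0) → (∀ i, m i ≤ lam → P i b = 0) →
      ‖a‖ + ‖b‖ ≤ r₀ → ∃ (y : ℝ → H) (c : ι → ℝ → H), Continuous y ∧ (∀ t, ‖y t‖ < R) ∧
        Continuous (fun t => N (y t)) ∧
        (∀ i t, HasDerivAt (c i) (P i (N (y t)) - m i • c i t) t) ∧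
        (∀ t, 0 ≤ t → ∀ i, P i (y t) = √(1 + m i) • c i t) ∧
        (∀ i, lam < m i → P i (y 0) = P i b) ∧
        Tendsto (fun t => Real.exp (lam * t) • y t) atTop (𝓝 a) := by
  set δ := min ε (p * lam) / 2 with hδ
  set κ := lam + δ with hκ
  set q := (1 + p) * lam with hq
  have hpl : 0 < p * lam := by positivity
  have hδ0 : 0 < δ := by positivity
  have hκq : κ < q := by
    have : min ε (p * lam) ≤ p * lam := min_le_right _ _
    linarith
  have hgap' : ∀ i, m i ≤ lam ∨ κ + δ ≤ m i := fun i => by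
    have : min ε (p * lam) ≤ ε := min_le_left _ _
    exact (hgap i).imp id fun h => by linarith
  have hgap'' : ∀ i, δ ≤ |m i - κ| := fun i => by
    rcases hgap' i with h | h
    · rw [abs_sub_comm]; exact (by linarith : δ ≤ κ - m i).trans (le_abs_self _)
    · exact (by linarith : δ ≤ m i - κ).trans (le_abs_self _)
  set C := √(decayConst κ q δ) with hC
  have hC0 : 0 ≤ C := Real.sqrt_nonneg _
  obtain ⟨ρ, hρ0, hρR, hρ⟩ := exists_radius hR hp (C * (2 * L))
  set Λ := 2 * L * ρ ^ p with hΛ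
  have hΛ0 : 0 ≤ Λ := by positivity
  have hCΛ : C * Λ ≤ 1 / 2 := by rw [hΛ, ← mul_assoc]; exact hρ
  refine ⟨ρ / 2, by positivity, fun a b ha0 hb0 hab => ?_⟩
  have hball : ∀ x : Metric.closedBall (0 : ℝ≥0 →ᵇ H) ρ, ‖(x : ℝ≥0 →ᵇ H)‖ ≤ ρ := fun x =>
    mem_closedBall_zero_iff.1 x.2
  have hlt : ∀ (x : Metric.closedBall (0 : ℝ≥0 →ᵇ H) ρ) t, ‖unweight lam x.1 t‖ < R := fun x t =>
    ((norm_unweight_le' hlam.le _).trans (hball x)).trans_lt hρR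
  have hcN : ∀ x : Metric.closedBall (0 : ℝ≥0 →ᵇ H) ρ,
      Continuous fun t => N (unweight lam x.1 t) := fun x => by
    have hLip : LipschitzOnWith Λ.toNNReal N (Metric.closedBall 0 ρ) := by
      refine LipschitzOnWith.of_dist_le_mul fun y hy z hz => ?_
      rw [mem_closedBall_zero_iff] at hy hz
      rw [dist_eq_norm, dist_eq_norm, Real.coe_toNNReal _ hΛ0]
      refine (hN y z (by linarith) (by linarith)).trans ?_
      have h1 : ‖y‖ ^ p ≤ ρ ^ p := by gcongr
      have h2 : ‖z‖ ^ p ≤ ρ ^ p := by gcongr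
      calc _ ≤ L * (ρ ^ p + ρ ^ p) * ‖y - z‖ := by gcongr
        _ = _ := by rw [hΛ]; ring
    refine hLip.continuousOn.comp_continuous (continuous_unweight lam x.1) fun t => ?_
    rw [mem_closedBall_zero_iff]
    exact (norm_unweight_le' hlam.le _).trans (hball x)
  have hNd : ∀ (x x' : Metric.closedBall (0 : ℝ≥0 →ᵇ H) ρ) (t : ℝ), 0 ≤ t →
      ‖N (unweight lam x.1 t) - N (unweight lam x'.1 t)‖ ≤
        Λ * ‖x.1 - x'.1‖ * Real.exp (-q * t) := fun x x' t ht => by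
    refine (hN _ _ (hlt x t) (hlt x' t)).trans ?_
    have hpow : ∀ x : Metric.closedBall (0 : ℝ≥0 →ᵇ H) ρ,
        ‖unweight lam x.1 t‖ ^ p ≤ Real.exp (-(p * lam) * t) * ρ ^ p := fun x => by
      calc _ ≤ (Real.exp (-lam * t) * ρ) ^ p := by
            gcongr
            refine norm_unweight_le x.1 |>.trans ?_
            rw [Real.coe_toNNReal t ht]
            gcongr
            exact hball x
        _ = _ := by
            rw [Real.mul_rpow (Real.exp_pos _).le hρ0.le, ← Real.exp_mul]
            ring_nf
    rw [← unweight_sub]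
    have h1 := norm_unweight_le (lam := lam) (x.1 - x'.1) (t := t)
    rw [Real.coe_toNNReal t ht] at h1
    calc _ ≤ L * (Real.exp (-(p * lam) * t) * ρ ^ p + Real.exp (-(p * lam) * t) * ρ ^ p) *
          (Real.exp (-lam * t) * ‖x.1 - x'.1‖) := by
          gcongr
          · exact hpow x
          · exact hpow x'
      _ = _ := by
          have : Real.exp (-q * t) = Real.exp (-(p * lam) * t) * Real.exp (-lam * t) := by
            rw [← Real.exp_add, hq]; ring_nf
          rw [this, hΛ]; ring
  have hzero : unweight lam (0 : ℝ≥0 →ᵇ H) = 0 := by ext t; simp [unweight]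
  have hN1 : ∀ (x : Metric.closedBall (0 : ℝ≥0 →ᵇ H) ρ) (t : ℝ), 0 ≤ t →
      ‖N (unweight lam x.1 t)‖ ≤ Λ * ρ * Real.exp (-q * t) := fun x t ht => by
    have := hNd x ⟨0, by simp [hρ0.le]⟩ t ht
    simp only [hzero, Pi.zero_apply, hN0, sub_zero] at this
    refine this.trans ?_
    gcongr
    exact hball x
  have hstep := fun x : Metric.closedBall (0 : ℝ≥0 →ᵇ H) ρ =>
    hP.exists_linear_decaying hm hlam hκ hκq hδ0 hgap' (hcN x) (by positivity) (hN1 x) ha0 hb0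
  choose Φ hΦ hΦn hΦa using hstep
  have hCΛρ : C * (Λ * ρ) ≤ ρ / 2 := by
    rw [← mul_assoc]
    nlinarith
  have hΦb : ∀ x, Φ x ∈ Metric.closedBall (0 : ℝ≥0 →ᵇ H) ρ := fun x => by
    rw [mem_closedBall_zero_iff]
    linarith [hΦn x, norm_add_le a b]
  have hLp : ∀ (x : Metric.closedBall (0 : ℝ≥0 →ᵇ H) ρ) i,
      MemLp (fun s => Real.exp (κ * s) • P i (N (unweight lam x.1 s))) 2
        (volume.restrict (Ioi 0)) := fun x i => by
    simpa only [Function.comp_def, map_smul] using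
      (P i).comp_memLp' (memLp_exp_smul hκq (hcN x) (hN1 x)).1
  set Ψ : Metric.closedBall (0 : ℝ≥0 →ᵇ H) ρ → Metric.closedBall (0 : ℝ≥0 →ᵇ H) ρ :=
    fun x => ⟨Φ x, hΦb x⟩ with hΨ
  have hcontr : ContractingWith (1 / 2) Ψ := by
    refine ⟨by norm_num, LipschitzWith.of_dist_le_mul fun x x' => ?_⟩
    rw [Subtype.dist_eq, Subtype.dist_eq, dist_eq_norm, dist_eq_norm]
    refine (BoundedContinuousFunction.norm_le (by positivity)).2 fun t => ?_
    obtain ⟨y, hy, hyn⟩ := hP.exists_decaySol hm (κ := κ) (by linarith) hκq hδ0 hgap''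
      ((hcN x).sub (hcN x')) (by positivity) (hNd x x') t.2
    have hyeq : (Φ x - Φ x') t = Real.exp (lam * t) • y := hP.ext fun i => by
      have h1 := linComp_sub (m := m i) (κ := κ) (P i (a + b))
        ((P i).continuous.comp (hcN x)) ((P i).continuous.comp (hcN x')) (hLp x i) (hLp x' i) t
      rw [BoundedContinuousFunction.coe_sub, Pi.sub_apply, map_sub, hΦ, hΦ, map_smul, hy,
        ← smul_sub, ← smul_sub]
      refine congrArg _ (congrArg _ (h1.trans ?_))
      congr 1
      funext s
      exact (map_sub (P i) _ _).symm
    change ‖(Φ x - Φ x') t‖ ≤ _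
    rw [hyeq, norm_smul, Real.norm_eq_abs, Real.abs_exp]
    have hexp : Real.exp (lam * t) * Real.exp (-κ * t) ≤ 1 := by
      rw [← Real.exp_add, Real.exp_le_one_iff]
      have := t.2
      nlinarith
    calc _ ≤ Real.exp (lam * t) * (C * (Λ * ‖x.1 - x'.1‖) * Real.exp (-κ * t)) := by
          gcongr
          exact hyn
      _ = (C * Λ) * ‖x.1 - x'.1‖ * (Real.exp (lam * t) * Real.exp (-κ * t)) := by ring
      _ ≤ 1 / 2 * ‖x.1 - x'.1‖ * 1 := by gcongr
      _ = _ := by simp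
  have hcs : CompleteSpace (Metric.closedBall (0 : ℝ≥0 →ᵇ H) ρ) :=
    Metric.isClosed_closedBall.completeSpace_coe
  have hne : Nonempty (Metric.closedBall (0 : ℝ≥0 →ᵇ H) ρ) := ⟨⟨0, by simp [hρ0.le]⟩⟩
  obtain ⟨x, hx⟩ : ∃ x, Ψ x = x := ⟨_, hcontr.fixedPoint_isFixedPt⟩
  have hx' : Φ x = x.1 := congrArg Subtype.val hx
  have hexp1 : ∀ t, Real.exp (-lam * t) * Real.exp (lam * t) = 1 := fun t => by
    rw [← Real.exp_add, neg_mul, neg_add_cancel, Real.exp_zero]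
  have hcomp : ∀ t, 0 ≤ t → ∀ i, P i (unweight lam x.1 t) = √(1 + m i) •
      linComp (m i) κ (P i (a + b)) (fun s => P i (N (unweight lam x.1 s))) t := fun t ht i => by
    have := hΦ x t.toNNReal i
    rw [hx', Real.coe_toNNReal t ht] at this
    rw [unweight_of_nonneg _ _ ht, map_smul, this, smul_smul, hexp1, one_smul]
  refine ⟨unweight lam x.1, fun i => linComp (m i) κ (P i (a + b))
    (fun s => P i (N (unweight lam x.1 s))), continuous_unweight _ _, hlt x, hcN x,
    fun i t => hasDerivAt_duhamel _ _ ((P i).continuous.comp (hcN x)) t, hcomp, fun i hi => ?_, ?_⟩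
  · have hi' : ¬ m i < κ := by
      rcases hgap' i with h | h <;> linarith
    rw [hcomp 0 le_rfl, sqrt_smul_linComp (hm i), decaySol, duhamel, decayInit, if_neg hi',
      map_add, ha0 i hi.ne']
    simp
  · rw [tendsto_iff_norm_sub_tendsto_zero]
    have hlim : Tendsto (fun t : ℝ => Real.exp (-δ * t) * (‖b‖ + C * (Λ * ρ))) atTop (𝓝 0) := by
      have : Tendsto (fun t : ℝ => Real.exp (-δ * t)) atTop (𝓝 0) :=
        Real.tendsto_exp_atBot.comp (tendsto_id.const_mul_atTop_of_neg (by linarith))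
      simpa using this.mul_const (‖b‖ + C * (Λ * ρ))
    refine squeeze_zero' (.of_forall fun _ => norm_nonneg _) ?_ hlim
    filter_upwards [eventually_ge_atTop 0] with t ht
    have := hΦa x t.toNNReal
    rw [hx', Real.coe_toNNReal t ht] at this
    rwa [unweight_of_nonneg _ _ ht, smul_smul, mul_comm (Real.exp _), hexp1, one_smul]

end FastSolutions

namespace FastSolutions

variable {H : Type*} [NormedAddCommGroup H] [InnerProductSpace ℝ H] {ι : Type*}

theorem eq_zero_of_le_integral {G : ℝ → ℝ} {T K : ℝ} (hG : ContinuousOn G (Icc 0 T))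
    (hG0 : ∀ t ∈ Icc 0 T, 0 ≤ G t)
    (hle : ∀ t ∈ Icc 0 T, G t ≤ K * ∫ s in (0 : ℝ)..t, G s) : ∀ t ∈ Icc 0 T, G t = 0 := by
  intro t ht
  have hT : 0 ≤ T := ht.1.trans ht.2
  have hGi : ∀ s ∈ Icc 0 T, IntervalIntegrable G volume 0 s := fun s hs =>
    (hG.mono (by rw [uIcc_of_le hs.1]; exact Icc_subset_Icc_right hs.2)).intervalIntegrable
  have hF0 : ∀ s ∈ Icc 0 T, 0 ≤ ∫ r in (0 : ℝ)..s, G r := fun s hs =>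
    intervalIntegral.integral_nonneg hs.1 fun r hr => hG0 r ⟨hr.1, hr.2.trans hs.2⟩
  have hFc : ContinuousOn (fun s => ∫ r in (0 : ℝ)..s, G r) (Icc 0 T) := by
    have := intervalIntegral.continuousOn_primitive_interval' (hGi T ⟨hT, le_rfl⟩) left_mem_uIcc
    rwa [uIcc_of_le hT] at this
  have hz := norm_le_gronwallBound_of_norm_deriv_right_le (δ := 0) (ε := 0) (K := K)
    (f' := G) hFc (fun s hs => ?_) (by simp) (fun s hs => ?_) t ht
  · rw [gronwallBound_ε0_δ0, norm_le_zero_iff] at hz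
    have := hle t ht
    rw [hz, mul_zero] at this
    exact le_antisymm this (hG0 t ht)
  · have hs' : s ∈ Icc 0 T := Ico_subset_Icc_self hs
    have hnhds : Icc 0 T ∈ 𝓝[>] s :=
      mem_of_superset (Ioo_mem_nhdsGT hs.2) fun r hr => ⟨hs.1.trans hr.1.le, hr.2.le⟩
    exact intervalIntegral.integral_hasDerivWithinAt_right (hGi s hs')
      ⟨Icc 0 T, hnhds, hG.aestronglyMeasurable measurableSet_Icc⟩
      ((hG s hs').mono_of_mem_nhdsWithin hnhds)
  · have hs' : s ∈ Icc 0 T := Ico_subset_Icc_self hs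
    rw [add_zero, Real.norm_of_nonneg (hG0 s hs'), Real.norm_of_nonneg (hF0 s hs')]
    exact hle s hs'

/-- Energy estimate for one component of the difference of two solutions. -/
theorem sq_norm_le_integral [CompleteSpace H] {m : ℝ} (hm : 0 ≤ m) {c h : ℝ → H} {t : ℝ}
    (ht : 0 ≤ t) (hcc : ContinuousOn c (Icc 0 t)) (hhc : ContinuousOn h (Icc 0 t))
    (hc : ∀ s ∈ Icc 0 t, c s = ∫ r in (0 : ℝ)..s, (h r - m • c r)) :
    (1 + m) * ‖c t‖ ^ 2 ≤ ∫ s in (0 : ℝ)..t, ((1 + m) * ‖c s‖ ^ 2 + 2 * ‖h s‖ ^ 2) := by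
  have hk : ContinuousOn (fun r => h r - m • c r) (Icc 0 t) := by fun_prop
  have hd : ∀ s ∈ Ioo 0 t, HasDerivAt c (h s - m • c s) s := fun s hs => by
    have hI : IntervalIntegrable (fun r => h r - m • c r) volume 0 s :=
      (hk.mono (by rw [uIcc_of_le hs.1.le]; exact Icc_subset_Icc_right hs.2.le)).intervalIntegrable
    have := intervalIntegral.integral_hasDerivAt_right hI
      ((hk.mono Ioo_subset_Icc_self).stronglyMeasurableAtFilter isOpen_Ioo s hs)
      (hk.continuousAt (Icc_mem_nhds hs.1 hs.2))
    refine this.congr_of_eventuallyEq ?_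
    filter_upwards [Icc_mem_nhds hs.1 hs.2] with r hr using hc r hr
  have hI : ∀ {F : ℝ → ℝ}, ContinuousOn F (Icc 0 t) → IntervalIntegrable F volume 0 t :=
    fun hF => ContinuousOn.intervalIntegrable (by rwa [uIcc_of_le ht])
  have hφ := intervalIntegral.integral_eq_sub_of_hasDerivAt_of_le (f := fun s => (1 + m) * ‖c s‖ ^ 2)
    (f' := fun s => (1 + m) * (2 * inner ℝ (c s) (h s - m • c s))) ht (by fun_prop)
    (fun s hs => ((hd s hs).norm_sq).const_mul _) (hI (by fun_prop))
  have h0 : c 0 = 0 := by rw [hc 0 ⟨le_rfl, ht⟩, intervalIntegral.integral_same]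
  rw [h0, norm_zero, zero_pow two_ne_zero, mul_zero, sub_zero] at hφ
  rw [← hφ]
  refine intervalIntegral.integral_mono_on ht (hI (by fun_prop)) (hI (by fun_prop)) fun s _ => ?_
  have h1 : 0 ≤ ‖c s - h s‖ ^ 2 := sq_nonneg _
  have h2 : 0 ≤ ‖m • c s - h s‖ ^ 2 := sq_nonneg _
  rw [@norm_sub_sq_real] at h1 h2
  rw [norm_smul, mul_pow, Real.norm_eq_abs, sq_abs, inner_smul_left, conj_trivial] at h2
  rw [inner_sub_right, inner_smul_right, real_inner_self_eq_norm_sq]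
  nlinarith [mul_nonneg hm (sq_nonneg ‖c s‖), mul_nonneg (sq_nonneg m) (sq_nonneg ‖c s‖)]

/-- Uniqueness: the difference `y = (1 + A)^{1/2} (u - v)` of two solutions vanishes. -/
theorem IsResolution.eq_zero_of_difference [CompleteSpace H] {P : ι → H →L[ℝ] H}
    (hP : IsResolution P) {m : ι → ℝ} (hm : ∀ i, 0 ≤ m i) {T K : ℝ} {y h : ℝ → H}
    {c : ι → ℝ → H} (hy : ContinuousOn y (Icc 0 T)) (hh : ContinuousOn h (Icc 0 T))
    (hyc : ∀ t ∈ Icc 0 T, ∀ i, P i (y t) = √(1 + m i) • c i t)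
    (hhy : ∀ t ∈ Icc 0 T, ‖h t‖ ≤ K * ‖y t‖)
    (hc : ∀ i, ∀ t ∈ Icc 0 T, c i t = ∫ s in (0 : ℝ)..t, (P i (h s) - m i • c i s)) :
    ∀ t ∈ Icc 0 T, y t = 0 := by
  have hs : ∀ i, √(1 + m i) ≠ 0 := fun i => (Real.sqrt_pos.2 (by linarith [hm i])).ne'
  have hcc : ∀ i, ContinuousOn (c i) (Icc 0 T) := fun i => by
    have : ContinuousOn (fun t => (√(1 + m i))⁻¹ • P i (y t)) (Icc 0 T) := by fun_prop
    exact this.congr fun t ht => by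
      simp only [hyc t ht, inv_smul_smul₀ (hs i)]
  have hn : ∀ t ∈ Icc 0 T, ∀ i, ‖P i (y t)‖ ^ 2 = (1 + m i) * ‖c i t‖ ^ 2 := fun t ht i => by
    rw [hyc t ht, norm_smul, mul_pow, Real.norm_eq_abs, sq_abs,
      Real.sq_sqrt (by linarith [hm i])]
  have key : ∀ t ∈ Icc 0 T, ‖y t‖ ^ 2 = 0 := by
    refine eq_zero_of_le_integral (K := 1 + 2 * K ^ 2) (hy.norm.pow 2)
      (fun _ _ => sq_nonneg _) fun t ht => ?_
    have hsub : Icc 0 t ⊆ Icc 0 T := Icc_subset_Icc_right ht.2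
    have hI : ∀ {F : ℝ → ℝ}, ContinuousOn F (Icc 0 T) → IntegrableOn F (Ioc 0 t) := fun hF =>
      ((hF.mono hsub).integrableOn_Icc).mono_set Ioc_subset_Icc_self
    have hM : ∀ {F : ℝ → H}, ContinuousOn F (Icc 0 T) →
        AEStronglyMeasurable F (volume.restrict (Ioc 0 t)) := fun hF =>
      (hF.mono (Ioc_subset_Icc_self.trans hsub)).aestronglyMeasurable measurableSet_Ioc
    obtain ⟨sy, by1⟩ := hP.summable_integral (hI (hy.norm.pow 2)) (hM hy)
    obtain ⟨sh, bh⟩ := hP.summable_integral (hI (hh.norm.pow 2)) (hM hh)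
    have hcomp : ∀ i, ‖P i (y t)‖ ^ 2 ≤ (∫ s in Ioc 0 t, ‖P i (y s)‖ ^ 2) +
        2 * ∫ s in Ioc 0 t, ‖P i (h s)‖ ^ 2 := fun i => by
      have h1 := sq_norm_le_integral (hm i) ht.1 ((hcc i).mono hsub)
        (h := fun s => P i (h s)) ((P i).continuous.comp_continuousOn (hh.mono hsub))
        fun s hs' => hc i s (hsub hs')
      rw [hn t ht, ← integral_const_mul, ← integral_add (hI (by fun_prop)) (hI (by fun_prop))]
      refine h1.trans (le_of_eq ?_)
      rw [intervalIntegral.integral_of_le ht.1]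
      refine setIntegral_congr_fun measurableSet_Ioc fun s hs' => ?_
      simp only [hn s (hsub (Ioc_subset_Icc_self hs'))]
    have h2 := (hP.hasSum_norm_sq (y t)).tsum_eq.symm.le.trans
      ((hP.hasSum_norm_sq (y t)).summable.tsum_le_tsum hcomp (sy.add (sh.mul_left 2)))
    rw [sy.tsum_add (sh.mul_left 2), tsum_mul_left] at h2
    have h3 : ∫ s in Ioc 0 t, ‖h s‖ ^ 2 ≤ K ^ 2 * ∫ s in Ioc 0 t, ‖y s‖ ^ 2 := by
      rw [← integral_const_mul]
      refine setIntegral_mono_on (hI (hh.norm.pow 2)) ((hI (hy.norm.pow 2)).const_mul _)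
        measurableSet_Ioc fun s hs' => ?_
      rw [← mul_pow]
      exact pow_le_pow_left₀ (norm_nonneg _) (hhy s (hsub (Ioc_subset_Icc_self hs'))) 2
    rw [intervalIntegral.integral_of_le ht.1]
    linarith
  intro t ht
  simpa using key t ht

end FastSolutions

namespace FastSolutions

variable {E : Type*} [NormedAddCommGroup E] [InnerProductSpace ℝ E]

/-- The Cauchy–Schwarz inequality for a nonnegative symmetric operator. -/
theorem inner_sq_le_of_nonneg {N : E →L[ℝ] E} (hs : ∀ x y, inner ℝ (N x) y = inner ℝ x (N y))
    (hN : ∀ x, 0 ≤ inner ℝ (N x) x) (x y : E) :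
    inner ℝ (N x) y ^ 2 ≤ inner ℝ (N x) x * inner ℝ (N y) y := by
  have h := discrim_le_zero (a := inner ℝ (N y) y) (b := 2 * inner ℝ (N x) y)
    (c := inner ℝ (N x) x) fun t => by
      have := hN (x + t • y)
      rw [map_add, map_smul, inner_add_left, inner_add_right, inner_add_right, inner_smul_left,
        inner_smul_left, inner_smul_right, inner_smul_right, hs y x,
        real_inner_comm (N x) y] at this
      simp only [conj_trivial] at this
      linarith
  rw [discrim] at h
  linarith

theorem norm_sq_le_of_nonneg {N : E →L[ℝ] E} (hs : ∀ x y, inner ℝ (N x) y = inner ℝ x (N y))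
    (hN : ∀ x, 0 ≤ inner ℝ (N x) x) {k : ℝ} (hk : ∀ x, ‖N x‖ ≤ k * ‖x‖) (x : E) :
    ‖N x‖ ^ 2 ≤ k * inner ℝ (N x) x := by
  rcases eq_or_ne (N x) 0 with h | h
  · simp [h]
  have h0 : 0 < ‖N x‖ ^ 2 := by positivity
  have h1 := inner_sq_le_of_nonneg hs hN x (N x)
  rw [real_inner_self_eq_norm_sq] at h1
  have h2 : inner ℝ (N (N x)) (N x) ≤ k * ‖N x‖ ^ 2 := by
    calc _ ≤ ‖N (N x)‖ * ‖N x‖ := real_inner_le_norm _ _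
      _ ≤ k * ‖N x‖ * ‖N x‖ := by gcongr; exact hk _
      _ = _ := by ring
  have h3 : (‖N x‖ ^ 2) * ‖N x‖ ^ 2 ≤ (k * inner ℝ (N x) x) * ‖N x‖ ^ 2 := by
    nlinarith [mul_le_mul_of_nonneg_left h2 (hN x)]
  exact le_of_mul_le_mul_right h3 h0

/-- If `T - z` is bounded below for every `z` at distance less than `r` from `0`, then `T` is
bounded below by `r`. -/
theorem le_norm_of_forall_boundedBelow {T : E →L[ℝ] E}
    (hs : ∀ x y, inner ℝ (T x) y = inner ℝ x (T y)) {r : ℝ}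
    (h : ∀ z, |z| < r → ∃ d > 0, ∀ x, d * ‖x‖ ≤ ‖T x - z • x‖) (x : E) : r * ‖x‖ ≤ ‖T x‖ := by
  by_contra! hx
  set S : Set ℝ := {c | 0 ≤ c ∧ ∀ x, c * ‖x‖ ≤ ‖T x‖} with hS
  have hx0 : 0 < ‖x‖ := by
    rw [norm_pos_iff]
    rintro rfl
    simp at hx
  have hb : ∀ c ∈ S, c ≤ ‖T x‖ / ‖x‖ := fun c hc => (le_div_iff₀ hx0).2 (hc.2 x)
  have hSb : BddAbove S := ⟨_, hb⟩
  have hS0 : (0 : ℝ) ∈ S := ⟨le_rfl, fun x => by simp⟩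
  set c := sSup S with hc
  have hc0 : 0 ≤ c := le_csSup hSb hS0
  have hcr : c < r := (csSup_le ⟨0, hS0⟩ hb).trans_lt ((div_lt_iff₀ hx0).2 hx)
  have hcT : ∀ x, c * ‖x‖ ≤ ‖T x‖ := fun x => by
    rcases (norm_nonneg x).eq_or_lt' with h | h
    · simp [h]
    · rw [← le_div_iff₀ h]
      exact csSup_le ⟨0, hS0⟩ fun c hc => (le_div_iff₀ h).2 (hc.2 x)
  obtain ⟨d₁, hd₁, h₁⟩ := h c (by rwa [abs_of_nonneg hc0])
  obtain ⟨d₂, hd₂, h₂⟩ := h (-c) (by rwa [abs_neg, abs_of_nonneg hc0])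
  set Z : E →L[ℝ] E := T.comp T - c ^ 2 • ContinuousLinearMap.id ℝ E with hZ
  have hZx : ∀ x, Z x = T (T x) - c ^ 2 • x := fun x => rfl
  have hZs : ∀ x y, inner ℝ (Z x) y = inner ℝ x (Z y) := fun x y => by
    simp only [hZx, inner_sub_left, inner_sub_right, inner_smul_left, inner_smul_right, hs,
      conj_trivial]
  have hZi : ∀ x, inner ℝ (Z x) x = ‖T x‖ ^ 2 - c ^ 2 * ‖x‖ ^ 2 := fun x => by
    rw [hZx, inner_sub_left, hs, inner_smul_left, real_inner_self_eq_norm_sq,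
      real_inner_self_eq_norm_sq, conj_trivial]
  have hZ0 : ∀ x, 0 ≤ inner ℝ (Z x) x := fun x => by
    rw [hZi, ← mul_pow, sub_nonneg]
    exact pow_le_pow_left₀ (by positivity) (hcT x) 2
  have hZb : ∀ x, d₂ * (d₁ * ‖x‖) ≤ ‖Z x‖ := fun x => by
    have h3 := h₂ (T x - c • x)
    have h4 : T (T x - c • x) - -c • (T x - c • x) = Z x := by
      rw [hZx, map_sub, map_smul, neg_smul, smul_sub, smul_smul, sq]
      abel
    rw [h4] at h3
    refine le_trans ?_ h3
    gcongr
    exact h₁ x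
  set k := ‖Z‖ + 1 with hk
  have hk0 : 0 < k := by positivity
  have hZk : ∀ x, ‖Z x‖ ≤ k * ‖x‖ := fun x =>
    (Z.le_opNorm x).trans (by rw [hk]; nlinarith [norm_nonneg x])
  set e := (d₂ * d₁) ^ 2 / k with he
  have he0 : 0 < e := by positivity
  have hbig : ∀ x, (c ^ 2 + e) * ‖x‖ ^ 2 ≤ ‖T x‖ ^ 2 := fun x => by
    have h5 := norm_sq_le_of_nonneg hZs hZ0 hZk x
    have h6 : (d₂ * d₁) ^ 2 * ‖x‖ ^ 2 ≤ ‖Z x‖ ^ 2 := by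
      rw [← mul_pow, mul_assoc]
      exact pow_le_pow_left₀ (by positivity) (hZb x) 2
    have h7 : e * ‖x‖ ^ 2 ≤ inner ℝ (Z x) x := by
      rw [he, div_mul_eq_mul_div, div_le_iff₀ hk0]
      linarith
    rw [hZi] at h7
    linarith
  have hmem : √(c ^ 2 + e) ∈ S := by
    refine ⟨Real.sqrt_nonneg _, fun x => abs_le_of_sq_le_sq' ?_ (norm_nonneg _) |>.2⟩
    rw [mul_pow, Real.sq_sqrt (by positivity)]
    exact hbig x
  have h8 := le_csSup hSb hmem
  have h9 : c < √(c ^ 2 + e) := Real.lt_sqrt_of_sq_lt (by linarith)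
  linarith

/-- A nonzero nonnegative symmetric operator has an eigenvector, if there is a gap in the spectrum
below the top. -/
theorem exists_eigenvector_of_gap [CompleteSpace E] [Nontrivial E] {T : E →L[ℝ] E}
    (hs : ∀ x y, inner ℝ (T x) y = inner ℝ x (T y)) (hT : ∀ x, 0 ≤ inner ℝ (T x) x)
    (hinj : ∀ x, T x = 0 → x = 0)
    (hgap : ∀ z > (0 : ℝ), (∃ d > 0, ∀ x, d * ‖x‖ ≤ ‖T x - z • x‖) ∨
      ∃ g > (0 : ℝ), ∀ z' ∈ Ioo (z - g) z, ∃ d > 0, ∀ x, d * ‖x‖ ≤ ‖T x - z' • x‖) :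
    ∃ z > (0 : ℝ), ∃ x ≠ 0, T x = z • x := by
  set m := ‖T‖ with hm
  have hm0 : 0 < m := by
    obtain ⟨x, hx⟩ := exists_ne (0 : E)
    refine norm_pos_iff.2 fun h => hx (hinj x ?_)
    rw [h]; rfl
  have happ : ¬ ∃ d > 0, ∀ x, d * ‖x‖ ≤ ‖T x - m • x‖ := by
    rintro ⟨d, hd, h⟩
    have h1 : ∀ x, ‖T x‖ ^ 2 ≤ (m ^ 2 - d ^ 2) * ‖x‖ ^ 2 := fun x => by
      have h2 := norm_sq_le_of_nonneg hs hT T.le_opNorm x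
      have h3 : (d * ‖x‖) ^ 2 ≤ ‖T x - m • x‖ ^ 2 := pow_le_pow_left₀ (by positivity) (h x) 2
      rw [@norm_sub_sq_real, inner_smul_right, norm_smul, mul_pow, mul_pow, Real.norm_eq_abs,
        sq_abs] at h3
      linarith
    have h4 : m ≤ √(m ^ 2 - d ^ 2) := by
      refine T.opNorm_le_bound (Real.sqrt_nonneg _) fun x => ?_
      refine (Real.le_sqrt_of_sq_le (h1 x)).trans_eq ?_
      rw [Real.sqrt_mul' _ (sq_nonneg _), Real.sqrt_sq (norm_nonneg _)]
    rw [Real.le_sqrt' hm0] at h4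
    nlinarith
  obtain ⟨g, hg, hg'⟩ := (hgap m hm0).resolve_left happ
  refine ⟨m, hm0, ?_⟩
  by_contra! hne
  set N : E →L[ℝ] E := m • ContinuousLinearMap.id ℝ E - T with hN
  have hNx : ∀ x, N x = m • x - T x := fun x => rfl
  have hNs : ∀ x y, inner ℝ (N x) y = inner ℝ x (N y) := fun x y => by
    simp only [hNx, inner_sub_left, inner_sub_right, inner_smul_left, inner_smul_right, hs,
      conj_trivial]
  have hN0 : ∀ x, 0 ≤ inner ℝ (N x) x := fun x => by
    rw [hNx, inner_sub_left, inner_smul_left, real_inner_self_eq_norm_sq, conj_trivial]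
    have h1 := real_inner_le_norm (T x) x
    nlinarith [T.le_opNorm x, norm_nonneg x]
  set M : E →L[ℝ] E := T - (m - g / 2) • ContinuousLinearMap.id ℝ E with hM
  have hMx : ∀ x, M x = T x - (m - g / 2) • x := fun x => rfl
  have hMb := le_norm_of_forall_boundedBelow (T := M) (r := g / 2) (fun x y => by
    simp only [hMx, inner_sub_left, inner_sub_right, inner_smul_left, inner_smul_right, hs,
      conj_trivial]) fun z hz => by
    rw [abs_lt] at hz
    obtain ⟨d, hd, h⟩ := hg' (m - g / 2 + z) ⟨by linarith, by linarith⟩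
    refine ⟨d, hd, fun x => (h x).trans_eq ?_⟩
    rw [hMx, add_smul, sub_sub]
  have hNg : ∀ x, g * inner ℝ (N x) x ≤ ‖N x‖ ^ 2 := fun x => by
    have h1 : M x = (g / 2) • x - N x := by rw [hMx, hNx, sub_smul]; abel
    have h2 := pow_le_pow_left₀ (by positivity) (hMb x) 2
    rw [h1, @norm_sub_sq_real, mul_pow, norm_smul, mul_pow, Real.norm_eq_abs, sq_abs,
      inner_smul_left, conj_trivial, real_inner_comm] at h2
    linarith
  have hNr : ∀ x, g * ‖N x‖ ^ 2 ≤ inner ℝ (N (N x)) (N x) := fun x => by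
    rcases eq_or_ne (N x) 0 with h | h
    · simp [h]
    have h0 : 0 < ‖N x‖ ^ 2 := by positivity
    have h1 := inner_sq_le_of_nonneg hNs hN0 x (N x)
    rw [real_inner_self_eq_norm_sq] at h1
    have h2 := mul_le_mul_of_nonneg_right (hNg x) (hN0 (N x))
    refine le_of_mul_le_mul_right ?_ h0
    nlinarith
  have hdense : Dense (LinearMap.range (N : E →ₗ[ℝ] E) : Set E) := by
    rw [Submodule.dense_iff_topologicalClosure_eq_top, Submodule.topologicalClosure_eq_top_iff,
      Submodule.eq_bot_iff]
    intro y hy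
    by_contra hy0
    refine hne y hy0 ?_
    have h1 : N y = 0 := by
      rw [← inner_self_eq_zero (𝕜 := ℝ), ← hNs]
      exact hy _ ⟨N y, rfl⟩
    rw [hNx, sub_eq_zero] at h1
    exact h1.symm
  have hall : ∀ y, g * ‖y‖ ^ 2 ≤ inner ℝ (N y) y := by
    have hcl : IsClosed {y : E | g * ‖y‖ ^ 2 ≤ inner ℝ (N y) y} :=
      isClosed_le (by fun_prop) (by fun_prop)
    intro y
    refine hdense.induction (P := fun y => g * ‖y‖ ^ 2 ≤ inner ℝ (N y) y) ?_ hcl y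
    rintro _ ⟨x, rfl⟩
    exact hNr x
  refine happ ⟨g, hg, fun x => ?_⟩
  rcases eq_or_ne x 0 with rfl | hx
  · simp
  have hx0 : 0 < ‖x‖ := norm_pos_iff.2 hx
  rw [norm_sub_rev, ← hNx]
  refine le_of_mul_le_mul_right ?_ hx0
  linarith [hall x, real_inner_le_norm (N x) x]

end FastSolutions

namespace FastSolutions

variable {H : Type*} [NormedAddCommGroup H] [InnerProductSpace ℝ H] {A : H →ₗ.[ℝ] H}

theorem mem_eigenspace {μ : ℝ} {x : H} : x ∈ eigenspace A μ ↔ (x, μ • x) ∈ A.graph := Iff.rfl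

theorem notMem_spectrum_iff {μ : ℝ} : μ ∉ spectrum A ↔ ∃ R : H →L[ℝ] H,
    (∀ y, (R y, y + μ • R y) ∈ A.graph) ∧ ∀ x z, (x, z) ∈ A.graph → R (z - μ • x) = x := by
  simp only [spectrum, mem_ofPred_eq, not_not]
  refine exists_congr fun R => and_congr (forall_congr' fun y => ?_) ?_
  · rw [LinearPMap.mem_graph_iff]
    constructor
    · rintro ⟨h, h'⟩
      exact ⟨⟨_, h⟩, rfl, sub_eq_iff_eq_add.1 h'⟩
    · rintro ⟨⟨x, hx⟩, h, h'⟩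
      simp only at h h'
      subst h
      exact ⟨hx, by rw [h']; simp⟩
  · constructor
    · rintro h x z hxz
      obtain ⟨w, hw, hw'⟩ := (LinearPMap.mem_graph_iff A).1 hxz
      simp only at hw hw'
      rw [← hw, ← hw']
      exact h w
    · exact fun h x => h x (A x) (A.mem_graph x)

theorem IsEigenvalue.mem_spectrum {μ : ℝ} (h : IsEigenvalue A μ) : μ ∈ spectrum A := by
  by_contra hμ
  obtain ⟨R, -, hR⟩ := notMem_spectrum_iff.1 hμ
  obtain ⟨x, hx, hx0⟩ := h
  have := hR x _ (mem_eigenspace.1 hx)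
  rw [sub_self, map_zero] at this
  exact hx0 this.symm

theorem HasDiscreteSpectrum.countable (h : HasDiscreteSpectrum A) : (spectrum A).Countable := by
  rcases h.2 with h | ⟨l, -, h⟩
  · exact h.countable
  · rw [h]; exact countable_range l

theorem HasDiscreteSpectrum.exists_gap (h : HasDiscreteSpectrum A) {μ : ℝ}
    (hμ : μ ∈ spectrum A) : ∃ ε > 0, ∀ ν ∈ spectrum A, ν ≤ μ ∨ μ + ε ≤ ν := by
  rcases h.2 with h | ⟨l, hl, h⟩
  · have hfin : {ν ∈ spectrum A | μ < ν}.Finite := h.subset fun ν hν => hν.1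
    obtain ⟨ε, hε, hb⟩ := Metric.isOpen_iff.1 hfin.isClosed.isOpen_compl μ fun h => h.2.false
    refine ⟨ε, hε, fun ν hν => ?_⟩
    by_contra! hc
    refine hb (a := ν) ?_ ⟨hν, hc.1⟩
    rw [Metric.mem_ball, Real.dist_eq, abs_of_pos (by linarith)]
    linarith
  · rw [h] at hμ ⊢
    obtain ⟨k, rfl⟩ := hμ
    refine ⟨l (k + 1) - l k, sub_pos.2 (hl k.lt_succ_self), ?_⟩
    rintro _ ⟨j, rfl⟩
    rcases le_or_gt j k with h | h
    · exact .inl (hl.monotone h)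
    · refine .inr ?_
      have := hl.monotone (Nat.succ_le_of_lt h)
      rw [Nat.succ_eq_add_one] at this
      linarith

theorem IsNonneg.inner_graph (hA0 : IsNonneg A) {x y : H} (h : (x, y) ∈ A.graph) :
    0 ≤ inner ℝ y x := by
  obtain ⟨a, ha, ha'⟩ := (LinearPMap.mem_graph_iff A).1 h
  simp only at ha ha'
  rw [← ha, ← ha']
  exact hA0 a

theorem IsNonneg.eigenvalue_nonneg (hA0 : IsNonneg A) {μ : ℝ} (h : IsEigenvalue A μ) : 0 ≤ μ := by
  obtain ⟨x, hx, hx0⟩ := h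
  have := hA0.inner_graph (mem_eigenspace.1 hx)
  rw [inner_smul_left, conj_trivial, real_inner_self_eq_norm_sq] at this
  exact nonneg_of_mul_nonneg_left this (by positivity)

/-- The resolvent `(1 + A)⁻¹`. -/
theorem exists_resolvent (hA0 : IsNonneg A) (hspec : HasDiscreteSpectrum A) :
    ∃ B : H →L[ℝ] H, (∀ y, (B y, y - B y) ∈ A.graph) ∧
      ∀ x z, (x, z) ∈ A.graph → B (z + x) = x := by
  have h : (-1 : ℝ) ∉ spectrum A := fun h => by
    have := hA0.eigenvalue_nonneg (hspec.1 _ h)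
    linarith
  obtain ⟨B, hB, hB'⟩ := notMem_spectrum_iff.1 h
  refine ⟨B, fun y => ?_, fun x z hxz => ?_⟩
  · simpa [sub_eq_add_neg] using hB y
  · simpa using hB' x z hxz

theorem boundedBelow_of_notMem_spectrum {B : H →L[ℝ] H} (hB : ∀ y, (B y, y - B y) ∈ A.graph)
    {z : ℝ} (hz : 0 < z) (h : 1 / z - 1 ∉ spectrum A) :
    ∃ d > 0, ∀ x, d * ‖x‖ ≤ ‖B x - z • x‖ := by
  obtain ⟨R, -, hR⟩ := notMem_spectrum_iff.1 h
  refine ⟨(z⁻¹ * (1 + ‖R‖ * z⁻¹))⁻¹, by positivity, fun x => ?_⟩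
  rw [inv_mul_le_iff₀ (by positivity)]
  set w := x - z⁻¹ • B x with hw
  have h1 : R w = B x := by
    rw [← hR _ _ (hB x), hw, one_div, sub_smul, one_smul]
    congr 1
    abel
  have h2 : ‖w‖ = z⁻¹ * ‖B x - z • x‖ := by
    have : w = (-z⁻¹) • (B x - z • x) := by
      rw [neg_smul, smul_sub, inv_smul_smul₀ hz.ne', neg_sub]
    rw [this, norm_smul, norm_neg, Real.norm_of_nonneg (by positivity)]
  have h3 : ‖x‖ ≤ ‖w‖ + z⁻¹ * (‖R‖ * ‖w‖) := by
    have : x = w + z⁻¹ • R w := by rw [h1, hw]; abel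
    calc ‖x‖ = ‖w + z⁻¹ • R w‖ := by rw [← this]
      _ ≤ ‖w‖ + ‖z⁻¹ • R w‖ := norm_add_le _ _
      _ ≤ _ := by
        rw [norm_smul, Real.norm_of_nonneg (by positivity : 0 ≤ z⁻¹)]
        gcongr
        exact R.le_opNorm w
  rw [h2] at h3
  linarith

variable [CompleteSpace H]

theorem inner_graph (hA : IsSelfAdjoint A) {x y x' y' : H} (h : (x, y) ∈ A.graph)
    (h' : (x', y') ∈ A.graph) : inner ℝ y x' = inner ℝ x y' := by
  obtain ⟨a, ha, ha'⟩ := (LinearPMap.mem_graph_iff A).1 h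
  obtain ⟨b, hb, hb'⟩ := (LinearPMap.mem_graph_iff A).1 h'
  simp only at ha ha' hb hb'
  have := LinearPMap.adjoint_isFormalAdjoint hA.dense_domain
  rw [LinearPMap.isSelfAdjoint_def.1 hA] at this
  rw [← ha, ← ha', ← hb, ← hb']
  exact this a b

theorem isClosed_eigenspace (hA : IsSelfAdjoint A) (μ : ℝ) :
    IsClosed (eigenspace A μ : Set H) := by
  have h : IsClosed (A.graph : Set (H × H)) := hA.isClosed
  exact h.preimage (f := fun x : H => (x, μ • x)) (by fun_prop)

theorem inner_eigenspace (hA : IsSelfAdjoint A) {μ ν : ℝ} (hμν : μ ≠ ν) {x y : H}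
    (hx : x ∈ eigenspace A μ) (hy : y ∈ eigenspace A ν) : inner ℝ x y = 0 := by
  have h := inner_graph hA (mem_eigenspace.1 hx) (mem_eigenspace.1 hy)
  rw [inner_smul_left, inner_smul_right, conj_trivial] at h
  have h' : (μ - ν) * inner ℝ x y = 0 := by linarith
  exact (mul_eq_zero.1 h').resolve_left (sub_ne_zero.2 hμν)

/-- The eigenvectors of an operator with discrete spectrum are complete. -/
theorem iSup_eigenspace_orthogonal (hA : IsSelfAdjoint A) (hA0 : IsNonneg A)
    (hspec : HasDiscreteSpectrum A) : (⨆ μ : spectrum A, eigenspace A μ)ᗮ = ⊥ := by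
  set K := (⨆ μ : spectrum A, eigenspace A μ)ᗮ with hK
  by_contra hbot
  have hnt : Nontrivial K := Submodule.nontrivial_iff_ne_bot.2 hbot
  have hmemK : ∀ x, x ∈ K ↔ ∀ μ, ∀ e ∈ eigenspace A μ, inner ℝ e x = 0 := fun x => by
    rw [hK, ← Submodule.iInf_orthogonal, Submodule.mem_iInf]
    refine ⟨fun h μ e he => ?_, fun h μ e he => h μ e he⟩
    rcases eq_or_ne e 0 with rfl | he0
    · simp
    · exact h ⟨μ, IsEigenvalue.mem_spectrum ⟨e, he, he0⟩⟩ e he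
  obtain ⟨B, hB, hB'⟩ := exists_resolvent hA0 hspec
  have hBs : ∀ x y, inner ℝ (B x) y = inner ℝ x (B y) := fun x y => by
    have := inner_graph hA (hB x) (hB y)
    rw [inner_sub_left, inner_sub_right] at this
    linarith
  have hB0 : ∀ x, 0 ≤ inner ℝ (B x) x := fun x => by
    have := hA0.inner_graph (hB x)
    rw [inner_sub_left, real_inner_self_eq_norm_sq, real_inner_comm] at this
    nlinarith [sq_nonneg ‖B x‖]
  have hBK : ∀ x ∈ K, B x ∈ K := fun x hx => by
    rw [hmemK] at hx ⊢
    intro μ e he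
    rw [← hBs]
    rcases eq_or_ne e 0 with rfl | he0
    · simp
    have hμ := hA0.eigenvalue_nonneg ⟨e, he, he0⟩
    have h1 := hB' _ _ (mem_eigenspace.1 he)
    rw [map_add, map_smul] at h1
    replace h1 : (μ + 1) • B e = e := by rw [add_smul, one_smul, h1]
    have h2 := hx μ e he
    rw [← h1, inner_smul_left] at h2
    exact (mul_eq_zero.1 h2).resolve_left (by simp only [conj_trivial]; linarith)
  set T : K →L[ℝ] K := (B.comp K.subtypeL).codRestrict K fun x => hBK x x.2 with hT
  have hTx : ∀ x : K, (T x : H) = B x := fun x => rfl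
  have hbb : ∀ z > 0, 1 / z - 1 ∉ spectrum A → ∃ d > 0, ∀ x, d * ‖x‖ ≤ ‖T x - z • x‖ :=
    fun z hz h => by
      obtain ⟨d, hd, hd'⟩ := boundedBelow_of_notMem_spectrum hB hz h
      exact ⟨d, hd, fun x => hd' x⟩
  obtain ⟨z, hz, x, hx0, hx⟩ := exists_eigenvector_of_gap (T := T) (fun x y => hBs x y)
    (fun x => hB0 x) (fun x hx => by
      have h1 : B x = 0 := congrArg Subtype.val hx
      have h2 := hB x
      rw [h1, sub_zero] at h2
      exact Subtype.ext (A.graph_fst_eq_zero_snd h2 rfl)) fun z hz => by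
    by_cases hμ : 1 / z - 1 ∈ spectrum A
    · obtain ⟨ε, hε, hgap⟩ := hspec.exists_gap hμ
      have hw : 0 < 1 / z + ε := by positivity
      have hwz : 1 / (1 / z + ε) < z := by
        rw [div_lt_iff₀ hw]
        have : z * (1 / z) = 1 := by field_simp
        nlinarith
      refine .inr ⟨z - 1 / (1 / z + ε), sub_pos.2 hwz, fun z' hz' => ?_⟩
      rw [sub_sub_cancel] at hz'
      have hz'0 : 0 < z' := (one_div_pos.2 hw).trans hz'.1
      refine hbb z' hz'0 fun h => ?_
      rcases hgap _ h with h | h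
      · have := one_div_lt_one_div_of_lt hz'0 hz'.2
        linarith
      · have := one_div_lt_one_div_of_lt (one_div_pos.2 hw) hz'.1
        rw [one_div_one_div] at this
        linarith
    · exact .inl (hbb z hz hμ)
  have hxB : B x = z • (x : H) := congrArg Subtype.val hx
  have he : (x : H) ∈ eigenspace A (z⁻¹ - 1) := by
    have h1 := A.graph.smul_mem z⁻¹ (hB x)
    rw [hxB, Prod.smul_mk, smul_sub, inv_smul_smul₀ hz.ne'] at h1
    rwa [mem_eigenspace, sub_smul, one_smul]
  have := (hmemK x).1 x.2 _ x he
  rw [inner_self_eq_zero] at this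
  exact hx0 (Subtype.ext this)

theorem eigenproj_eq_self_iff (hA : IsSelfAdjoint A) {μ : ℝ} {x : H} :
    eigenproj A μ x = x ↔ x ∈ eigenspace A μ := by
  rw [eigenproj, Submodule.starProjection_eq_self_iff,
    (isClosed_eigenspace hA μ).submodule_topologicalClosure_eq]

theorem eigenproj_mem (hA : IsSelfAdjoint A) (μ : ℝ) (x : H) :
    eigenproj A μ x ∈ eigenspace A μ := by
  have : eigenproj A μ x ∈ (eigenspace A μ).topologicalClosure :=
    Submodule.starProjection_apply_mem _ x
  rwa [(isClosed_eigenspace hA μ).submodule_topologicalClosure_eq] at this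

theorem inner_eigenproj (μ : ℝ) (x y : H) :
    inner ℝ (eigenproj A μ x) y = inner ℝ x (eigenproj A μ y) :=
  Submodule.inner_starProjection_left_eq_right _ x y

theorem eigenproj_of_mem_ne (hA : IsSelfAdjoint A) {μ ν : ℝ} (h : μ ≠ ν) {x : H}
    (hx : x ∈ eigenspace A ν) : eigenproj A μ x = 0 := by
  rw [← inner_self_eq_zero (𝕜 := ℝ), inner_eigenproj,
    (eigenproj_eq_self_iff hA).2 (eigenproj_mem hA μ x)]
  exact inner_eigenspace hA h.symm hx (eigenproj_mem hA μ x)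

theorem eigenproj_of_notMem_spectrum (hA : IsSelfAdjoint A) {μ : ℝ} (h : μ ∉ spectrum A) :
    eigenproj A μ = 0 := by
  ext x
  by_contra hx
  exact h (IsEigenvalue.mem_spectrum ⟨_, eigenproj_mem hA μ x, hx⟩)

/-- The spectral projections of an operator with discrete spectrum. -/
theorem isResolution_eigenproj (hA : IsSelfAdjoint A) (hA0 : IsNonneg A)
    (hspec : HasDiscreteSpectrum A) :
    IsResolution fun μ : spectrum A => eigenproj A (μ : ℝ) where
  sym μ x y := inner_eigenproj _ x y
  idem μ x := (eigenproj_eq_self_iff hA).2 (eigenproj_mem hA _ x)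
  orth μ ν h x := eigenproj_of_mem_ne hA (fun h' => h (Subtype.ext h')) (eigenproj_mem hA _ x)
  hasSum x := by
    have hc : ∀ μ : spectrum A, CompleteSpace (eigenspace A (μ : ℝ)) := fun μ =>
      (isClosed_eigenspace hA μ).completeSpace_coe
    have hV : OrthogonalFamily ℝ (fun μ : spectrum A => eigenspace A (μ : ℝ))
        fun μ => (eigenspace A (μ : ℝ)).subtypeₗᵢ := fun μ ν h x y =>
      inner_eigenspace hA (fun h' => h (Subtype.ext h')) x.2 y.2
    have hS := IsHilbertSum.mkInternal (F := fun μ : spectrum A => eigenspace A (μ : ℝ)) hV (by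
      rw [(Submodule.topologicalClosure_eq_top_iff).2 (iSup_eigenspace_orthogonal hA hA0 hspec)])
    obtain ⟨w, hw⟩ := hS.surjective_isometry x
    have hsum := hS.OrthogonalFamily.hasSum_linearIsometry w
    rw [hw] at hsum
    have hcomp : ∀ μ : spectrum A, eigenproj A (μ : ℝ) x = w μ := fun μ => by
      refine (hsum.mapL (eigenproj A (μ : ℝ))).unique ?_
      have h1 : ∀ ν : spectrum A, ν ≠ μ → eigenproj A (μ : ℝ) (w ν : H) = 0 := fun ν hν =>
        eigenproj_of_mem_ne hA (fun h' => hν (Subtype.ext h'.symm)) (w ν).2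
      have h2 := hasSum_single μ h1
      rwa [(eigenproj_eq_self_iff hA).2 (w μ).2] at h2
    simp only [hcomp]
    exact hsum

theorem mem_graph_iff_eigenproj (hA : IsSelfAdjoint A) (hA0 : IsNonneg A)
    (hspec : HasDiscreteSpectrum A) {x y : H} :
    (x, y) ∈ A.graph ↔ ∀ μ : spectrum A, eigenproj A (μ : ℝ) y = (μ : ℝ) • eigenproj A μ x := by
  have hP := isResolution_eigenproj hA hA0 hspec
  have hmp : ∀ {x y : H}, (x, y) ∈ A.graph → ∀ μ : spectrum A,
      eigenproj A (μ : ℝ) y = (μ : ℝ) • eigenproj A μ x := fun {x y} h μ => by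
    refine ext_inner_right ℝ fun v => ?_
    rw [inner_eigenproj, inner_graph hA h (mem_eigenspace.1 (eigenproj_mem hA μ v)), inner_smul_left,
      inner_smul_right, inner_eigenproj, conj_trivial]
  refine ⟨hmp, fun h => ?_⟩
  obtain ⟨B, hB, -⟩ := exists_resolvent hA0 hspec
  have h1 : B (y + x) = x := hP.ext fun μ => by
    have h2 := hmp (hB (y + x)) μ
    have hμ := hA0.eigenvalue_nonneg (hspec.1 _ μ.2)
    have h3 : (1 + (μ : ℝ)) • eigenproj A (μ : ℝ) (B (y + x)) =
        (1 + (μ : ℝ)) • eigenproj A (μ : ℝ) x := by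
      rw [map_sub, map_add, h μ, sub_eq_iff_eq_add] at h2
      rw [add_smul, add_smul, one_smul, one_smul, add_comm _ (_ • _), ← h2]
      abel
    exact smul_right_injective H (by linarith : (1 + (μ : ℝ)) ≠ 0) h3
  have h4 := hB (y + x)
  rwa [h1, add_sub_cancel_right] at h4

end FastSolutions

namespace FastSolutions

variable {H : Type*} [NormedAddCommGroup H] [InnerProductSpace ℝ H] [CompleteSpace H]
  {A : H →ₗ.[ℝ] H}

/-- The standing assumptions on the operator. -/
structure IsDiscreteNonneg (A : H →ₗ.[ℝ] H) : Prop where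
  selfAdjoint : IsSelfAdjoint A
  nonneg : IsNonneg A
  discrete : HasDiscreteSpectrum A

/-- `y = (1 + A)^{1/2} u`. -/
def HalfLift (A : H →ₗ.[ℝ] H) (u y : H) : Prop :=
  ∀ μ : spectrum A, eigenproj A (μ : ℝ) y = √(1 + (μ : ℝ)) • eigenproj A (μ : ℝ) u

namespace HalfLift

variable {u v y z : H}

theorem sub (h : HalfLift A u y) (h' : HalfLift A v z) : HalfLift A (u - v) (y - z) := fun μ => by
  rw [map_sub, map_sub, h μ, h' μ, smul_sub]

theorem smul (c : ℝ) (h : HalfLift A u y) : HalfLift A (c • u) (c • y) := fun μ => by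
  rw [map_smul, map_smul, h μ, smul_comm]

end HalfLift

namespace IsDiscreteNonneg

theorem isResolution (h : IsDiscreteNonneg A) : IsResolution fun μ : spectrum A => eigenproj A (μ : ℝ) :=
  isResolution_eigenproj h.selfAdjoint h.nonneg h.discrete

theorem spectrum_nonneg (h : IsDiscreteNonneg A) (μ : spectrum A) : 0 ≤ (μ : ℝ) :=
  h.nonneg.eigenvalue_nonneg (h.discrete.1 _ μ.2)

theorem sqrt_ne_zero (h : IsDiscreteNonneg A) (μ : spectrum A) : √(1 + (μ : ℝ)) ≠ 0 :=
  (Real.sqrt_pos.2 (by linarith [h.spectrum_nonneg μ])).ne'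

theorem eigenproj_idem (h : IsDiscreteNonneg A) (μ : ℝ) (x : H) : eigenproj A μ (eigenproj A μ x) = eigenproj A μ x :=
  (eigenproj_eq_self_iff h.selfAdjoint).2 (eigenproj_mem h.selfAdjoint _ x)

theorem summable_iff (h : IsDiscreteNonneg A) (u : H) : u ∈ (sqrtOp A).domain ↔
    Summable fun μ : spectrum A => (μ : ℝ) * ‖eigenproj A (μ : ℝ) u‖ ^ 2 := by
  have h1 : u ∈ (sqrtOp A).domain ↔ Summable fun μ : ℝ => √μ • eigenproj A μ u := Iff.rfl
  have h0 : ∀ μ ∉ range (Subtype.val : spectrum A → ℝ), √μ • eigenproj A μ u = 0 := fun μ hμ => by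
    rw [Subtype.range_coe] at hμ
    rw [eigenproj_of_notMem_spectrum h.selfAdjoint hμ]
    simp
  rw [h1, ← Subtype.val_injective.summable_iff h0, Function.comp_def,
    h.isResolution.summable_iff fun μ => by rw [map_smul, h.eigenproj_idem]]
  simp_rw [norm_smul, mul_pow, Real.norm_eq_abs, sq_abs, Real.sq_sqrt (h.spectrum_nonneg _)]

theorem hasSum_sqrtNorm (h : IsDiscreteNonneg A) {u : H} (hu : u ∈ (sqrtOp A).domain) :
    HasSum (fun μ : spectrum A => (μ : ℝ) * ‖eigenproj A (μ : ℝ) u‖ ^ 2) (sqrtNorm A u ^ 2) := by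
  have h0 : ∀ μ ∉ range (Subtype.val : spectrum A → ℝ), √μ • eigenproj A μ u = 0 := fun μ hμ => by
    rw [Subtype.range_coe] at hμ
    rw [eigenproj_of_notMem_spectrum h.selfAdjoint hμ]
    simp
  have hn : ∀ μ : spectrum A, ‖√(μ : ℝ) • eigenproj A (μ : ℝ) u‖ ^ 2 =
      (μ : ℝ) * ‖eigenproj A (μ : ℝ) u‖ ^ 2 := fun μ => by
    rw [norm_smul, mul_pow, Real.norm_eq_abs, sq_abs, Real.sq_sqrt (h.spectrum_nonneg _)]
  obtain ⟨y, hy, hy'⟩ := h.isResolution.exists_of_summable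
    (c := fun μ : spectrum A => √(μ : ℝ) • eigenproj A (μ : ℝ) u)
    (fun μ => by rw [map_smul, h.eigenproj_idem]) (by simpa only [hn] using (h.summable_iff u).1 hu)
  have hy2 := (Subtype.val_injective.hasSum_iff h0).1 hy
  have h3 : sqrtOp A ⟨u, hu⟩ = y := hy2.tsum_eq
  rw [sqrtNorm, dif_pos hu, h3]
  simpa only [hy', hn] using h.isResolution.hasSum_norm_sq y

theorem hasSum_halfNorm (h : IsDiscreteNonneg A) {u : H} (hu : u ∈ (sqrtOp A).domain) :
    HasSum (fun μ : spectrum A => (1 + (μ : ℝ)) * ‖eigenproj A (μ : ℝ) u‖ ^ 2)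
      (halfNorm A u ^ 2) := by
  rw [halfNorm, Real.sq_sqrt (by positivity)]
  simpa only [add_mul, one_mul] using
    (h.isResolution.hasSum_norm_sq u).add (h.hasSum_sqrtNorm hu)

theorem norm_sq_sqrt_smul (h : IsDiscreteNonneg A) (μ : spectrum A) (x : H) :
    ‖√(1 + (μ : ℝ)) • x‖ ^ 2 = (1 + (μ : ℝ)) * ‖x‖ ^ 2 := by
  rw [norm_smul, mul_pow, Real.norm_eq_abs, sq_abs,
    Real.sq_sqrt (by linarith [h.spectrum_nonneg μ])]

theorem exists_halfLift (h : IsDiscreteNonneg A) {u : H} (hu : u ∈ (sqrtOp A).domain) : ∃ y, HalfLift A u y := by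
  obtain ⟨y, -, hy⟩ := h.isResolution.exists_of_summable
    (c := fun μ : spectrum A => √(1 + (μ : ℝ)) • eigenproj A (μ : ℝ) u)
    (fun μ => by rw [map_smul, h.eigenproj_idem])
    (by simpa only [h.norm_sq_sqrt_smul] using (h.hasSum_halfNorm hu).summable)
  exact ⟨y, hy⟩

theorem exists_of_halfLift (h : IsDiscreteNonneg A) (y : H) : ∃ u, HalfLift A u y := by
  obtain ⟨u, hu, -⟩ := h.isResolution.exists_of_norm_le (k := 1) (x := y)
    (c := fun μ : spectrum A => (√(1 + (μ : ℝ)))⁻¹ • eigenproj A (μ : ℝ) y)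
    (fun μ => by rw [map_smul, h.eigenproj_idem]) zero_le_one fun μ => by
      rw [norm_smul, Real.norm_of_nonneg (by positivity)]
      gcongr
      exact inv_le_one_of_one_le₀ (Real.one_le_sqrt.2 (by linarith [h.spectrum_nonneg μ]))
  exact ⟨u, fun μ => by rw [hu, smul_inv_smul₀ (h.sqrt_ne_zero μ)]⟩

variable {u v y z : H}

theorem mem_domain (h : IsDiscreteNonneg A) (hy : HalfLift A u y) : u ∈ (sqrtOp A).domain := by
  rw [h.summable_iff]
  refine (h.isResolution.hasSum_norm_sq y).summable.of_nonneg_of_le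
    (fun μ => mul_nonneg (h.spectrum_nonneg μ) (sq_nonneg _)) fun μ => ?_
  rw [hy μ, h.norm_sq_sqrt_smul]
  nlinarith [sq_nonneg ‖eigenproj A (μ : ℝ) u‖]

theorem halfNorm_eq (h : IsDiscreteNonneg A) (hy : HalfLift A u y) : halfNorm A u = ‖y‖ := by
  have h1 := h.isResolution.hasSum_norm_sq y
  simp_rw [hy _, h.norm_sq_sqrt_smul] at h1
  have h2 := (h.hasSum_halfNorm (h.mem_domain hy)).unique h1
  exact (sq_eq_sq₀ (Real.sqrt_nonneg _) (norm_nonneg _)).1 h2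

theorem halfLift_left_unique (h : IsDiscreteNonneg A) (hu : HalfLift A u y) (hv : HalfLift A v y) : u = v :=
  h.isResolution.ext fun μ => smul_right_injective H (h.sqrt_ne_zero μ) <| by
    simp only [← hu μ, ← hv μ]

theorem norm_le_of_halfLift (h : IsDiscreteNonneg A) (hy : HalfLift A u y) : ‖u‖ ≤ ‖y‖ := by
  rw [← h.halfNorm_eq hy, halfNorm]
  exact Real.le_sqrt_of_sq_le (by nlinarith [sq_nonneg (sqrtNorm A u)])

theorem mem_halfBall_iff (h : IsDiscreteNonneg A) {R : ℝ} (hy : HalfLift A u y) : u ∈ halfBall A R ↔ ‖y‖ < R := by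
  rw [← h.halfNorm_eq hy]
  exact and_iff_right (h.mem_domain hy)

theorem halfLift_of_mem_eigenspace (h : IsDiscreteNonneg A) {lam : ℝ} {v : H} (hv : v ∈ eigenspace A lam) :
    HalfLift A v (√(1 + lam) • v) := fun μ => by
  rcases eq_or_ne (μ : ℝ) lam with hμ | hμ
  · rw [map_smul, hμ]
  · rw [map_smul, eigenproj_of_mem_ne h.selfAdjoint hμ hv, smul_zero, smul_zero]

theorem mem_closure_iSup_iff (h : IsDiscreteNonneg A) (s : Set ℝ) {x : H} :
    x ∈ (⨆ μ ∈ s, eigenspace A μ).topologicalClosure ↔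
      ∀ μ : spectrum A, (μ : ℝ) ∉ s → eigenproj A (μ : ℝ) x = 0 := by
  constructor
  · intro hx μ hμ
    have hle : (⨆ ν ∈ s, eigenspace A ν).topologicalClosure ≤
        LinearMap.ker (eigenproj A (μ : ℝ) : H →ₗ[ℝ] H) := by
      refine Submodule.topologicalClosure_minimal _ (iSup₂_le fun ν hν y hy => ?_)
        (eigenproj A (μ : ℝ)).isClosed_ker
      exact eigenproj_of_mem_ne h.selfAdjoint (ν := ν) (fun h' => hμ (by rwa [h'])) hy
    exact hle hx
  · intro hx
    refine mem_closure_of_tendsto (h.isResolution.hasSum x) (.of_forall fun F => ?_)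
    refine Submodule.sum_mem _ fun μ _ => ?_
    by_cases hμ : (μ : ℝ) ∈ s
    · exact Submodule.mem_iSup_of_mem (μ : ℝ)
        (Submodule.mem_iSup_of_mem hμ (eigenproj_mem h.selfAdjoint _ x))
    · rw [hx μ hμ]
      exact Submodule.zero_mem _

theorem mem_lowerSpace (h : IsDiscreteNonneg A) {lam : ℝ} {x : H} : x ∈ lowerSpace A lam ↔
    ∀ μ : spectrum A, lam < (μ : ℝ) → eigenproj A (μ : ℝ) x = 0 :=
  (h.mem_closure_iSup_iff (Iic lam)).trans (by simp only [mem_Iic, not_le])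

theorem mem_upperSpace (h : IsDiscreteNonneg A) {lam : ℝ} {x : H} : x ∈ upperSpace A lam ↔
    ∀ μ : spectrum A, (μ : ℝ) ≤ lam → eigenproj A (μ : ℝ) x = 0 :=
  (h.mem_closure_iSup_iff (Ioi lam)).trans (by simp only [mem_Ioi, not_lt])

theorem lowerSpace_orthogonal (h : IsDiscreteNonneg A) (lam : ℝ) : (lowerSpace A lam)ᗮ = upperSpace A lam := by
  ext x
  rw [h.mem_upperSpace]
  constructor
  · intro hx μ hμ
    rw [← inner_self_eq_zero (𝕜 := ℝ), inner_eigenproj, h.eigenproj_idem, real_inner_comm]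
    refine hx _ (h.mem_lowerSpace.2 fun ν hν => ?_)
    exact eigenproj_of_mem_ne h.selfAdjoint (hμ.trans_lt hν).ne' (eigenproj_mem h.selfAdjoint _ x)
  · intro hx y hy
    rw [h.mem_lowerSpace] at hy
    refine (h.isResolution.hasSum_inner y x).unique ?_
    have : ∀ μ : spectrum A, inner ℝ (eigenproj A (μ : ℝ) y) (eigenproj A (μ : ℝ) x) = 0 :=
      fun μ => by
        rcases le_or_gt (μ : ℝ) lam with hμ | hμ
        · rw [hx μ hμ, inner_zero_right]
        · rw [hy μ hμ, inner_zero_left]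
    simp only [this]
    exact hasSum_zero

end IsDiscreteNonneg

end FastSolutions

namespace FastSolutions

variable {H : Type*} [NormedAddCommGroup H] [InnerProductSpace ℝ H] [CompleteSpace H]
  {A : H →ₗ.[ℝ] H}

theorem absolutelyContinuousOnInterval_congr {f g : ℝ → ℝ} {a b : ℝ} (h : EqOn f g (uIcc a b))
    (hg : AbsolutelyContinuousOnInterval g a b) : AbsolutelyContinuousOnInterval f a b := by
  refine Tendsto.congr' ?_ hg
  filter_upwards [mem_inf_of_right (mem_principal_self _)] with E hE
  refine Finset.sum_congr rfl fun i hi => ?_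
  have := hE.1 i hi
  rw [h this.1, h this.2]

/-- The Lipschitz condition on the nonlinearity. -/
def LipschitzNonlinearity (A : H →ₗ.[ℝ] H) (R : ℝ) (f : H → H) (p L : ℝ) : Prop :=
  ∀ u ∈ halfBall A R, ∀ v ∈ halfBall A R,
    ‖f u - f v‖ ≤ L * (halfNorm A u ^ p + halfNorm A v ^ p) * halfNorm A (u - v)

namespace IsDiscreteNonneg

/-- The components of a solution solve the scalar equations. -/
theorem eigenproj_solution (h : IsDiscreteNonneg A) {R : ℝ} {f : H → H} {u₀ : H} {T : ℝ}
    {u : ℝ → H} (hu : IsSolutionOn A R f u₀ T u) (μ : spectrum A) {t : ℝ} (ht : t ∈ Icc 0 T) :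
    eigenproj A (μ : ℝ) (u t) = eigenproj A (μ : ℝ) u₀ +
      ∫ s in (0 : ℝ)..t, (eigenproj A (μ : ℝ) (f (u s)) - (μ : ℝ) • eigenproj A (μ : ℝ) (u s)) := by
  obtain ⟨du, Au, -, hdu, -, hint, hae⟩ := hu.strong
  have hsub : volume.restrict (Ioc 0 t) ≤ volume.restrict (Ioo 0 T) := by
    rw [← restrict_Ioo_eq_restrict_Ioc]
    exact Measure.restrict_mono (Ioo_subset_Ioo_right ht.2) le_rfl
  have hI : IntervalIntegrable du volume 0 t :=
    (intervalIntegrable_iff_integrableOn_Ioc_of_le ht.1).2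
      ((hdu.integrable one_le_two).mono_measure hsub)
  rw [hint t ht, hu.init, map_add, ← (eigenproj A (μ : ℝ)).intervalIntegral_comp_comm hI]
  congr 1
  rw [intervalIntegral.integral_of_le ht.1, intervalIntegral.integral_of_le ht.1]
  refine integral_congr_ae ?_
  filter_upwards [ae_mono hsub hae] with s hs
  obtain ⟨-, ⟨hd, hAu⟩, heq⟩ := hs
  have hg : (u s, Au s) ∈ A.graph := by
    rw [← hAu]
    exact A.mem_graph ⟨u s, hd⟩
  rw [← heq, map_add,
    (mem_graph_iff_eigenproj h.selfAdjoint h.nonneg h.discrete).1 hg μ, add_sub_cancel_right]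

theorem continuousOn_halfLift (h : IsDiscreteNonneg A) {T : ℝ} {u y : ℝ → H}
    (hu : ∀ t ∈ Icc 0 T, Tendsto (fun s => halfNorm A (u s - u t)) (𝓝[Icc 0 T] t) (𝓝 0))
    (hy : ∀ t ∈ Icc 0 T, HalfLift A (u t) (y t)) : ContinuousOn y (Icc 0 T) := fun t ht => by
  rw [ContinuousWithinAt, tendsto_iff_norm_sub_tendsto_zero]
  refine (hu t ht).congr' ?_
  filter_upwards [self_mem_nhdsWithin] with s hs
  exact h.halfNorm_eq ((hy s hs).sub (hy t ht))

theorem norm_sub_le_of_halfLift (h : IsDiscreteNonneg A) {R p L : ℝ} (hp : 0 < p) (hL : 0 ≤ L)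
    {f : H → H} (hf : LipschitzNonlinearity A R f p L) {u v y z : H} (hu : u ∈ halfBall A R)
    (hv : v ∈ halfBall A R) (hy : HalfLift A u y) (hz : HalfLift A v z) :
    ‖f u - f v‖ ≤ L * (2 * R ^ p) * ‖y - z‖ := by
  have h1 := hf u hu v hv
  rw [h.halfNorm_eq (hy.sub hz), h.halfNorm_eq hy, h.halfNorm_eq hz] at h1
  rw [h.mem_halfBall_iff hy] at hu
  rw [h.mem_halfBall_iff hz] at hv
  refine h1.trans ?_
  have h2 : ‖y‖ ^ p ≤ R ^ p := by gcongr
  have h3 : ‖z‖ ^ p ≤ R ^ p := by gcongr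
  have h4 : ‖y‖ ^ p + ‖z‖ ^ p ≤ 2 * R ^ p := by linarith
  gcongr

theorem continuousOn_comp (h : IsDiscreteNonneg A) {R p L : ℝ} (hp : 0 < p) (hL : 0 ≤ L)
    {f : H → H} (hf : LipschitzNonlinearity A R f p L) {T : ℝ} {u y : ℝ → H}
    (hu : ∀ t ∈ Icc 0 T, u t ∈ halfBall A R) (hy : ∀ t ∈ Icc 0 T, HalfLift A (u t) (y t))
    (hyc : ContinuousOn y (Icc 0 T)) : ContinuousOn (fun t => f (u t)) (Icc 0 T) := fun t ht => by
  rw [ContinuousWithinAt, tendsto_iff_norm_sub_tendsto_zero]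
  have h1 : Tendsto (fun s => L * (2 * R ^ p) * ‖y s - y t‖) (𝓝[Icc 0 T] t) (𝓝 0) := by
    simpa using (tendsto_iff_norm_sub_tendsto_zero.1 (hyc t ht)).const_mul (L * (2 * R ^ p))
  refine squeeze_zero' (.of_forall fun _ => norm_nonneg _) ?_ h1
  filter_upwards [self_mem_nhdsWithin] with s hs
  exact h.norm_sub_le_of_halfLift hp hL hf (hu s hs) (hu t ht) (hy s hs) (hy t ht)

theorem solution_unique (h : IsDiscreteNonneg A) {R p L : ℝ} (hp : 0 < p) (hL : 0 ≤ L)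
    {f : H → H} (hf : LipschitzNonlinearity A R f p L) {T : ℝ} {u₀ : H} {u v : ℝ → H}
    (hu : IsSolutionOn A R f u₀ T u) (hv : IsSolutionOn A R f u₀ T v) :
    ∀ t ∈ Icc 0 T, v t = u t := by
  have hex : ∀ {w : ℝ → H}, IsSolutionOn A R f u₀ T w →
      ∃ y : ℝ → H, ∀ t ∈ Icc 0 T, HalfLift A (w t) (y t) := fun {w} hw => by
    have : ∀ t, ∃ y, t ∈ Icc 0 T → HalfLift A (w t) y := fun t => by
      by_cases ht : t ∈ Icc 0 T
      · obtain ⟨y, hy⟩ := h.exists_halfLift (hw.mem_ball t ht).1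
        exact ⟨y, fun _ => hy⟩
      · exact ⟨0, fun h => absurd h ht⟩
    choose y hy using this
    exact ⟨y, hy⟩
  obtain ⟨y, hy⟩ := hex hu
  obtain ⟨z, hz⟩ := hex hv
  have hyc := h.continuousOn_halfLift hu.cont hy
  have hzc := h.continuousOn_halfLift hv.cont hz
  have hfu := h.continuousOn_comp hp hL hf hu.mem_ball hy hyc
  have hfv := h.continuousOn_comp hp hL hf hv.mem_ball hz hzc
  have hcomp : ∀ {w y : ℝ → H}, ContinuousOn y (Icc 0 T) →
      (∀ t ∈ Icc 0 T, HalfLift A (w t) (y t)) → ContinuousOn w (Icc 0 T) :=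
    fun {w y} hyc hy t ht => by
      rw [ContinuousWithinAt, tendsto_iff_norm_sub_tendsto_zero]
      refine squeeze_zero' (.of_forall fun _ => norm_nonneg _) ?_
        (tendsto_iff_norm_sub_tendsto_zero.1 (hyc t ht))
      filter_upwards [self_mem_nhdsWithin] with s hs
      exact h.norm_le_of_halfLift ((hy s hs).sub (hy t ht))
  have huc := hcomp hyc hy
  have hvc := hcomp hzc hz
  have key := h.isResolution.eq_zero_of_difference h.spectrum_nonneg (T := T)
    (K := L * (2 * R ^ p)) (y := fun t => z t - y t) (h := fun t => f (v t) - f (u t))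
    (c := fun μ t => eigenproj A (μ : ℝ) (v t - u t)) (hzc.sub hyc) (hfv.sub hfu)
    (fun t ht μ => (hz t ht).sub (hy t ht) μ)
    (fun t ht => h.norm_sub_le_of_halfLift hp hL hf (hv.mem_ball t ht) (hu.mem_ball t ht)
      (hz t ht) (hy t ht)) fun μ t ht => by
    have hII : ∀ {w : ℝ → H}, ContinuousOn w (Icc 0 T) →
        ContinuousOn (fun t => f (w t)) (Icc 0 T) →
        IntervalIntegrable (fun s => eigenproj A (μ : ℝ) (f (w s)) -
          (μ : ℝ) • eigenproj A (μ : ℝ) (w s)) volume 0 t := fun {w} hw hfw => by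
      refine ContinuousOn.intervalIntegrable ?_
      rw [uIcc_of_le ht.1]
      have : ContinuousOn (fun s => eigenproj A (μ : ℝ) (f (w s)) -
          (μ : ℝ) • eigenproj A (μ : ℝ) (w s)) (Icc 0 T) :=
        ((eigenproj A (μ : ℝ)).continuous.comp_continuousOn hfw).sub
          (((eigenproj A (μ : ℝ)).continuous.comp_continuousOn hw).const_smul _)
      exact this.mono (Icc_subset_Icc_right ht.2)
    rw [map_sub, h.eigenproj_solution hu μ ht, h.eigenproj_solution hv μ ht,
      add_sub_add_left_eq_sub,
      ← intervalIntegral.integral_sub (hII hvc hfv) (hII huc hfu)]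
    refine intervalIntegral.integral_congr fun s _ => ?_
    simp only [map_sub, smul_sub]
    abel
  intro t ht
  refine h.halfLift_left_unique (hz t ht) ?_
  rw [sub_eq_zero.1 (key t ht)]
  exact hy t ht

/-- A function whose components solve the scalar equations is a solution. -/
theorem isSolutionOn (h : IsDiscreteNonneg A) {R : ℝ} {f : H → H} {u y : ℝ → H}
    {c : spectrum A → ℝ → H} (huy : ∀ t, HalfLift A (u t) (y t)) (hy : Continuous y)
    (hyR : ∀ t, ‖y t‖ < R) (hfc : Continuous fun t => f (u t))
    (hc : ∀ μ : spectrum A, ∀ t,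
      HasDerivAt (c μ) (eigenproj A (μ : ℝ) (f (u t)) - (μ : ℝ) • c μ t) t)
    (hyc : ∀ t, 0 ≤ t → ∀ μ : spectrum A,
      eigenproj A (μ : ℝ) (y t) = √(1 + (μ : ℝ)) • c μ t) {T : ℝ} (hT : 0 < T) :
    IsSolutionOn A R f (u 0) T u := by
  have hcount : Countable (spectrum A) := h.discrete.countable.to_subtype
  have huc : ∀ t, 0 ≤ t → ∀ μ : spectrum A, eigenproj A (μ : ℝ) (u t) = c μ t := fun t ht μ =>
    smul_right_injective H (h.sqrt_ne_zero μ) <| by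
      simp only [← hyc t ht, ← huy t μ]
  have hdom : ∀ t, u t ∈ (sqrtOp A).domain := fun t => h.mem_domain (huy t)
  have hu : Continuous u := continuous_iff_continuousAt.2 fun t => by
    rw [ContinuousAt, tendsto_iff_norm_sub_tendsto_zero]
    exact squeeze_zero (fun _ => norm_nonneg _)
      (fun s => h.norm_le_of_halfLift ((huy s).sub (huy t)))
      (tendsto_iff_norm_sub_tendsto_zero.1 (hy.tendsto t))
  obtain ⟨Au, hAu, hAuc, hint, hE⟩ := h.isResolution.linear_regularity h.spectrum_nonneg hfc hc huc
    (by simpa only [← huc 0 le_rfl] using (h.hasSum_sqrtNorm (hdom 0)).summable) hT.le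
  have hmemLp : ∀ {w : ℝ → H}, Continuous w → MemLp w 2 (volume.restrict (Ioc 0 T)) :=
    fun {w} hw => by
      rw [memLp_two_iff_integrable_sq_norm hw.aestronglyMeasurable]
      have : Continuous fun t => ‖w t‖ ^ 2 := by fun_prop
      exact this.integrableOn_Ioc
  have hdu : MemLp (fun t => f (u t) - Au t) 2 (volume.restrict (Ioc 0 T)) :=
    (hmemLp hfc).sub hAu
  have hII : IntervalIntegrable (fun t => f (u t) - Au t) volume 0 T :=
    (intervalIntegrable_iff_integrableOn_Ioc_of_le hT.le).2 (hdu.integrable one_le_two)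
  refine ⟨rfl, fun t _ => (h.mem_halfBall_iff (huy t)).2 (hyR t), fun t _ => ?_,
    ⟨fun t => f (u t) - Au t, Au, ?_⟩, ?_⟩
  · simp_rw [h.halfNorm_eq ((huy _).sub (huy t))]
    exact tendsto_iff_norm_sub_tendsto_zero.1 (hy.continuousWithinAt (s := Icc 0 T) (x := t))
  · simp_rw [restrict_Ioo_eq_restrict_Ioc]
    refine ⟨hmemLp hu, hdu, hAu, hint, ?_⟩
    rw [← restrict_Ioo_eq_restrict_Ioc] at hAuc ⊢
    filter_upwards [hAuc, ae_restrict_of_ae hII.ae_hasDerivAt_integral,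
      ae_restrict_mem measurableSet_Ioo] with t hAt hdt htm
    refine ⟨?_, ?_, sub_add_cancel _ _⟩
    · have h1 := (hdt (by rw [uIcc_of_le hT.le]; exact Ioo_subset_Icc_self htm) 0
        left_mem_uIcc).const_add (u 0)
      refine h1.congr_of_eventuallyEq ?_
      filter_upwards [Icc_mem_nhds htm.1 htm.2] with s hs using hint s hs
    · have hg := (mem_graph_iff_eigenproj h.selfAdjoint h.nonneg h.discrete).2 hAt
      obtain ⟨⟨w, hw⟩, h1, h2⟩ := (LinearPMap.mem_graph_iff A).1 hg
      simp only at h1 h2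
      subst h1
      exact ⟨hw, h2⟩
  · have hin : Integrable (fun s => 2 * inner ℝ (Au s) (f (u s) - Au s))
        (volume.restrict (Ioc 0 T)) :=
      (memLp_one_iff_integrable.1 (hAu.of_bilin (r := 1) (p := 2) (q := 2) (inner ℝ) 1 hdu
        (hAu.1.inner hdu.1) (.of_forall fun s => by
          simpa using nnnorm_inner_le_nnnorm (𝕜 := ℝ) (Au s) (f (u s) - Au s)))).const_mul 2
    have hac := (IntervalIntegrable.absolutelyContinuousOnInterval_intervalIntegral
      ((intervalIntegrable_iff_integrableOn_Ioc_of_le hT.le).2 hin) left_mem_uIcc)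
    have hconst : AbsolutelyContinuousOnInterval
        (fun _ : ℝ => ∑' μ : spectrum A, (μ : ℝ) * ‖c μ 0‖ ^ 2) 0 T :=
      (LipschitzWith.const (β := ℝ) _).lipschitzOnWith.absolutelyContinuousOnInterval
    refine absolutelyContinuousOnInterval_congr (fun t ht => ?_) (hconst.add hac)
    rw [uIcc_of_le hT.le] at ht
    have h1 := h.hasSum_sqrtNorm (hdom t)
    simp_rw [huc t ht.1] at h1
    exact h1.unique (hE t ht)

end IsDiscreteNonneg

end FastSolutions

open FastSolutions in
theorem theorem2p3 {H : Type*} [NormedAddCommGroup H] [InnerProductSpace ℝ H] [CompleteSpace H]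
    (A : H →ₗ.[ℝ] H) (hA : IsSelfAdjoint A) (hA0 : IsNonneg A) (hspec : HasDiscreteSpectrum A)
    (R : ℝ) (hR : 0 < R) (f : H → H) (p L : ℝ) (hp : 0 < p) (hL : 0 ≤ L)
    (hf : ∀ u ∈ halfBall A R, ∀ v ∈ halfBall A R,
      ‖f u - f v‖ ≤ L * (halfNorm A u ^ p + halfNorm A v ^ p) * halfNorm A (u - v))
    (hf0 : f 0 = 0)
    (lam : ℝ) (hlam : 0 < lam) (hlamA : IsEigenvalue A lam) :
    (lowerSpace A lam)ᗮ = upperSpace A lam ∧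
    ∃ r₀ > 0, ∀ v₀ ∈ eigenspace A lam, ∀ w₀ ∈ upperSpace A lam, w₀ ∈ (sqrtOp A).domain →
      halfNorm A v₀ + halfNorm A w₀ ≤ r₀ →
      ∃ w₁ ∈ lowerSpace A lam, w₀ + w₁ ∈ halfBall A R ∧
        ∃ u : ℝ → H, IsUniqueGlobalSolution A R f (w₀ + w₁) u ∧
          Tendsto (fun t : ℝ => halfNorm A (Real.exp (lam * t) • u t - v₀)) atTop (𝓝 0) := by
  have h : IsDiscreteNonneg A := ⟨hA, hA0, hspec⟩
  refine ⟨h.lowerSpace_orthogonal lam, ?_⟩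
  have hcount : Countable (FastSolutions.spectrum A) := hspec.countable.to_subtype
  choose S hS using h.exists_of_halfLift
  obtain ⟨ε, hε, hgap⟩ := hspec.exists_gap hlamA.mem_spectrum
  have hS0 : S 0 = 0 := h.halfLift_left_unique (hS 0) fun μ => by simp
  obtain ⟨r₀, hr₀, hmain⟩ := h.isResolution.exists_decaying h.spectrum_nonneg hR hp hL
    (N := fun y => f (S y)) (fun y z hy hz => by
      have := hf (S y) ((h.mem_halfBall_iff (hS y)).2 hy) (S z) ((h.mem_halfBall_iff (hS z)).2 hz)
      rwa [h.halfNorm_eq ((hS y).sub (hS z)), h.halfNorm_eq (hS y), h.halfNorm_eq (hS z)] at this)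
    (by rw [hS0, hf0]) hlam hε fun μ => hgap μ μ.2
  refine ⟨r₀, hr₀, fun v₀ hv₀ w₀ hw₀ hw₀d hle => ?_⟩
  have ha := h.halfLift_of_mem_eigenspace hv₀
  obtain ⟨b, hb⟩ := h.exists_halfLift hw₀d
  rw [h.halfNorm_eq ha, h.halfNorm_eq hb] at hle
  obtain ⟨y, c, hyc, hyR, hfc, hc, hycc, hy0, hlim⟩ := hmain (√(1 + lam) • v₀) b
    (fun μ hμ => by rw [map_smul, eigenproj_of_mem_ne hA hμ hv₀, smul_zero])
    (fun μ hμ => by rw [hb μ, h.mem_upperSpace.1 hw₀ μ hμ, smul_zero]) hle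
  have hsol := fun (T : ℝ) (hT : 0 < T) =>
    h.isSolutionOn (R := R) (f := f) (fun t => hS (y t)) hyc hyR hfc hc hycc hT
  refine ⟨S (y 0) - w₀, h.mem_lowerSpace.2 fun μ hμ => ?_, ?_, fun t => S (y t), ?_, ?_⟩
  · refine smul_right_injective H (h.sqrt_ne_zero μ) ?_
    simp only
    rw [map_sub, smul_sub, ← hS (y 0) μ, ← hb μ, hy0 μ hμ, sub_self, smul_zero]
  · rw [add_sub_cancel]
    exact (h.mem_halfBall_iff (hS _)).2 (hyR 0)
  · rw [add_sub_cancel]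
    exact ⟨hsol, fun T hT v hv => h.solution_unique hp hL hf (hsol T hT) hv⟩
  · simp_rw [h.halfNorm_eq (((hS _).smul _).sub ha)]
    exact tendsto_iff_norm_sub_tendsto_zero.1 hlim
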